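/- Conventions. A curve is a continuous image of a compact interval, $\ell$ denotes length, and a metric space $(X,d)$ is a length space if $d(x,y)$ is the infimum of the lengths of the curves joining $x$ and $y$, for all $x,y\in X$. For $Q>1$, $X$ is $Q$-doubling if for each ball $B(x,r)$ every $r/2$-separated subset of $B(x,r)$ has at most $Q$ points. Let $\Omega\subsetneq X$ be a proper subdomain (a nonempty connected open set), and put $d_\Omega(z)=d(z,\partial\Omega)$. The inner distance $\sigma_\Omega(x,y)$ is the infimum of $\ell(\gamma)$, and the quasihyperbolic distance $k_\Omega(x,y)$ the infimum of $\ell_k(\gamma)=\int_\gamma \frac{|dz|}{d_\Omega(z)}$, over all rectifiable curves $\gamma\subset\Omega$ joining $x$ and $y$. A quasihyperbolic geodesic is a rectifiable curve in $\Omega$ with end points $x,y$ and $\ell_k(\gamma)=k_\Omega(x,y)$; $(\Omega,k_\Omega)$ is geodesic if any two points of $\Omega$ are joined by a quasihyperbolic geodesic. The domain $\Omega$ * is $c_0$-LLC-2 if for all $x\in\Omega$ and $r>0$, each pair of points $a,b\in\Omega\setminus\overline{B(x,r)}$ can be joined by a curve in $\Omega\setminus\overline{B(x,r/c_0)}$;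 * has the $C$-ball separation property if for each quasihyperbolic geodesic $\gamma_{xy}\subset\Omega$ with end points $x,y$, every $z\in\gamma_{xy}$ and every curve $\gamma\subset\Omega$ joining $x$ and $y$, one has $\{w\in\Omega:\sigma_\Omega(z,w)<C\,d_\Omega(z)\}\cap\gamma\neq\emptyset$; * is $c$-inner uniform, $c\ge1$, if each pair of points $z_1,z_2\in\Omega$ can be joined by a rectifiable curve $\gamma\subset\Omega$ with $\min_{j=1,2}\ell(\gamma[z_j,z])\le c\,d_\Omega(z)$ for all $z\in\gamma$ and $\ell(\gamma)\le c\,\sigma_\Omega(z_1,z_2)$; * satisfies the $C$-Gehring–Hayman inequality if $\ell(\gamma_{xy})\le C\,\sigma_\Omega(x,y)$ for all $x,y\in\Omega$ and every quasihyperbolic geodesic $\gamma_{xy}$ with end points $x$ and $y$. **Theorem.** Let $Q>1$, $c_0>0$, $C>0$, let $X$ be a $Q$-doubling length space, and let $\Omega\subsetneq X$ be a proper subdomain such that $(\Omega,k_\Omega)$ is geodesic. If $\Omega$ is $c_0$-LLC-2 and has the $C$-ball separation property, then $\Omega$ is $C_1$-inner uniform with $$C_1=\exp\!\left(C_2^{\,3+4C_2^2}\right),\qquad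 C_2=(42c_0C)^2\cdot Q^{(210c_0C)^2(\log_2(2Q)+1)} .$$ In particular, $\Omega$ satisfies the $C_1$-Gehring–Hayman inequality. -/

import Mathlib

open scoped ENNReal

namespace QHDomain

/-- `X` is a length space: any two points `x, y` are joined by curves whose length is as close
to `dist x y` as we please. A curve is a continuous path, and its length is its total variation. -/
def IsLengthSpace (X : Type*) [MetricSpace X] : Prop :=
  ∀ x y : X, ∀ ε : ℝ, 0 < ε →
    ∃ γ : Path x y, eVariationOn γ Set.univ ≤ ENNReal.ofReal (dist x y + ε)

/-- `X` is `Q`-doubling: every `r/2`-separated subset of a ball `B(x, r)` has at most `Q` points.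
(Testing finite subsets suffices: an infinite separated set has finite subsets of any size.) -/
def IsDoubling (X : Type*) [MetricSpace X] (Q : ℝ) : Prop :=
  ∀ (x : X) (r : ℝ), 0 < r → ∀ S : Finset X,
    (∀ y ∈ S, y ∈ Metric.ball x r) →
    (∀ y ∈ S, ∀ z ∈ S, y ≠ z → r / 2 ≤ dist y z) →
    (S.card : ℝ) ≤ Q

variable {X : Type*} [MetricSpace X]

/-- A proper subdomain of `X`: a nonempty connected open set different from `X`. -/
def IsProperSubdomain (Ω : Set X) : Prop :=
  IsOpen Ω ∧ IsConnected Ω ∧ Ω ≠ Set.univ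

/-- The distance `d_Ω(z) = d(z, ∂Ω)`. -/
noncomputable def bdryDist (Ω : Set X) (z : X) : ℝ :=
  Metric.infDist z (frontier Ω)

/-- The length of a curve, possibly infinite. -/
noncomputable def length {x y : X} (γ : Path x y) : ℝ≥0∞ :=
  eVariationOn γ Set.univ

/-- `γ` is a rectifiable curve that stays in `Ω`. -/
def IsRectifiableIn (Ω : Set X) {x y : X} (γ : Path x y) : Prop :=
  (∀ t, γ t ∈ Ω) ∧ length γ ≠ ⊤

/-- The inner distance `σ_Ω(x, y)`: the infimum of the lengths of the rectifiable curves in `Ω`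
that join `x` and `y`. -/
noncomputable def innerDist (Ω : Set X) (x y : X) : ℝ≥0∞ :=
  ⨅ (γ : Path x y) (_ : IsRectifiableIn Ω γ), length γ

/-- The arc-length parametrization of a rectifiable curve, on `[0, ℓ(γ)]`. -/
noncomputable def arcLengthParam {x y : X} (γ : Path x y) : ℝ → X :=
  naturalParameterization γ Set.univ 0

/-- The quasihyperbolic length `∫_γ |dz| / d_Ω(z)` of a rectifiable curve `γ` in `Ω`. -/
noncomputable def qhLength (Ω : Set X) {x y : X} (γ : Path x y) : ℝ≥0∞ :=
  ∫⁻ s in Set.Icc 0 (length γ).toReal, (ENNReal.ofReal (bdryDist Ω (arcLengthParam γ s)))⁻¹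

/-- The quasihyperbolic distance `k_Ω(x, y)`. Curves may be used in place of arcs, as a curve
joining two distinct points contains an arc joining them; the constant curve gives
`k_Ω(x, x) = 0`. -/
noncomputable def qhDist (Ω : Set X) (x y : X) : ℝ≥0∞ :=
  ⨅ (γ : Path x y) (_ : IsRectifiableIn Ω γ), qhLength Ω γ

/-- `γ` is a quasihyperbolic geodesic of `Ω`: a rectifiable curve in `Ω` whose quasihyperbolic
length is the quasihyperbolic distance of its end points. Such a curve has no loops, so up to
reparametrization it is an arc (or a constant curve when the end points agree). -/
def IsQHGeodesic (Ω : Set X) {x y : X} (γ : Path x y) : Prop :=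
  IsRectifiableIn Ω γ ∧ qhLength Ω γ = qhDist Ω x y

/-- `(Ω, k_Ω)` is geodesic: any two points of `Ω` are joined by a quasihyperbolic geodesic. -/
def IsQHGeodesicDomain (Ω : Set X) : Prop :=
  ∀ x ∈ Ω, ∀ y ∈ Ω, ∃ γ : Path x y, IsQHGeodesic Ω γ

/-- `Ω` is `c`-LLC-2: any two points of `Ω` outside the closure of `B(x, r)` are joined by a curve
in `Ω` outside the closure of `B(x, r / c)`. -/
def IsLLC2 (Ω : Set X) (c : ℝ) : Prop :=
  ∀ x ∈ Ω, ∀ r : ℝ, 0 < r →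
    ∀ a ∈ Ω \ closure (Metric.ball x r), ∀ b ∈ Ω \ closure (Metric.ball x r),
      JoinedIn (Ω \ closure (Metric.ball x (r / c))) a b

/-- The open ball `B_σ(z, r)` of the inner distance of `Ω`. -/
def innerBall (Ω : Set X) (z : X) (r : ℝ) : Set X :=
  {w | w ∈ Ω ∧ innerDist Ω z w < ENNReal.ofReal r}

/-- The `C`-ball separation condition: for every point `z` of a quasihyperbolic geodesic of `Ω`,
the ball `B_σ(z, C d_Ω(z))` meets every curve in `Ω` with the same end points. -/
def BallSeparation (Ω : Set X) (C : ℝ) : Prop :=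
  ∀ x ∈ Ω, ∀ y ∈ Ω, ∀ γ : Path x y, IsQHGeodesic Ω γ →
    ∀ z ∈ Set.range γ, ∀ α : Path x y, (∀ t, α t ∈ Ω) →
      (innerBall Ω z (C * bdryDist Ω z) ∩ Set.range α).Nonempty

/-- `Ω` is `c`-inner uniform: any two points `x, y` of `Ω` are joined by a rectifiable curve `γ`
in `Ω` with `min (ℓ(γ[x, z])) (ℓ(γ[z, y])) ≤ c d_Ω(z)` for every `z` on `γ`, and
`ℓ(γ) ≤ c σ_Ω(x, y)`. -/
def IsInnerUniform (Ω : Set X) (c : ℝ) : Prop :=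
  1 ≤ c ∧ ∀ x ∈ Ω, ∀ y ∈ Ω, ∃ γ : Path x y, IsRectifiableIn Ω γ ∧
    (∀ t, min (eVariationOn γ (Set.Iic t)) (eVariationOn γ (Set.Ici t)) ≤
      ENNReal.ofReal (c * bdryDist Ω (γ t))) ∧
    length γ ≤ ENNReal.ofReal c * innerDist Ω x y

/-- The `C`-Gehring–Hayman inequality: a quasihyperbolic geodesic `γ` from `x` to `y` has
`ℓ(γ) ≤ C σ_Ω(x, y)`. -/
def GehringHayman (Ω : Set X) (C : ℝ) : Prop :=
  ∀ x ∈ Ω, ∀ y ∈ Ω, ∀ γ : Path x y, IsQHGeodesic Ω γ →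
    length γ ≤ ENNReal.ofReal C * innerDist Ω x y

/-- The constant `C₂ = (42 c₀ C)² Q ^ ((210 c₀ C)² (log₂ (2 Q) + 1))`. -/
noncomputable def constC₂ (Q c₀ C : ℝ) : ℝ :=
  (42 * c₀ * C) ^ 2 * Q ^ ((210 * c₀ * C) ^ 2 * (Real.logb 2 (2 * Q) + 1))

/-- The constant `C₁ = exp (C₂ ^ (3 + 4 C₂²))`. -/
noncomputable def constC₁ (Q c₀ C : ℝ) : ℝ :=
  Real.exp (constC₂ Q c₀ C ^ (3 + 4 * constC₂ Q c₀ C ^ 2))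

end QHDomain

open scoped ENNReal

namespace QHDomain

variable {X : Type*} [MetricSpace X]

open Set MeasureTheory Filter Topology

/-! Both conclusions follow from two properties of quasihyperbolic geodesics: a length cigar
condition and a Gehring–Hayman bound.

Ball separation and LLC-2 enter once. If both end points of a geodesic were farther than `c₀ * C *
bdryDist Ω z` from a point `z` on it, LLC-2 would give a curve between them missing the ball that
separation forces it to meet. This is `DiamCigar` with constant `A = c₀ * C`. Doubling upgrades it
to `LengthCigar`: the parts of a geodesic at comparable boundary distance lie in one ball of
comparable radius, few smaller balls cover them, each costs a bounded multiple of that distance, and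
the dyadic sum is geometric (`sub_le_of_dist_le`).

By the length cigar, the first half of a geodesic is a track: at arc length `τ` it lies at boundary
distance at least `τ / M`, and its quasihyperbolic speed in `log τ` is at most `M`. The core is that
two tracks that start together cannot drift far apart. Suppose they reach distance `D`. At the last
scale `s` where their distance is `D / 2`, join them by a geodesic. Its two ends are again tracks,
up to a scale `κ * s` with `log κ` comparable to `D / M`. Comparing the two routes between the old
tracks at scale `κ * s` shows that one end has drifted from the track where it began. That pair
branches with gap `D / (32 * M)`, and the remaining old track joins the family of mutually far
tracks (`exists_isBranching_succ`). Doubling bounds the size of such a family, so `D` is bounded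
(`card_le_of_isBranching`).

For Gehring–Hayman, compare a geodesic `g` with a curve of length at most `δ` having the same end
points. Finely spaced points of that curve are joined to the midpoint of `g`; the two halves of `g`
are the extreme members of this fan. Neighbouring members stay close up to scale `δ`, and doubling
bounds the whole chain. Hence the middle part of `g` has bounded quasihyperbolic length, so its
length is at most a constant times `δ`. -/

/-! ### Arc length along a rectifiable path -/

/-- The length of the part of `γ` before time `t`. -/
noncomputable def arcPos {x y : X} (γ : Path x y) (t : unitInterval) : ℝ :=
  variationOnFromTo γ univ 0 t

section ArcLength

variable {x y : X} {γ : Path x y}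

lemma boundedVariationOn_of_length_ne_top (h : length γ ≠ ⊤) : BoundedVariationOn γ univ := h

lemma arcPos_zero : arcPos γ 0 = 0 := variationOnFromTo.self _ _ _

lemma arcPos_one : arcPos γ 1 = (length γ).toReal := by
  unfold arcPos length
  rw [variationOnFromTo.eq_of_le _ _ zero_le_one]
  congr 2
  ext t
  simp [unitInterval.le_one']

lemma arcPos_monotone (h : length γ ≠ ⊤) : Monotone (arcPos γ) := fun a b hab =>
  variationOnFromTo.monotoneOn (boundedVariationOn_of_length_ne_top h).locallyBoundedVariationOn
    (mem_univ (0 : unitInterval)) (mem_univ a) (mem_univ b) hab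

lemma arcPos_sub (h : length γ ≠ ⊤) {s t : unitInterval} (hst : s ≤ t) :
    ENNReal.ofReal (arcPos γ t - arcPos γ s) = eVariationOn γ (Icc s t) := by
  have hb := (boundedVariationOn_of_length_ne_top h).locallyBoundedVariationOn
  unfold arcPos
  rw [variationOnFromTo.sub_right hb (mem_univ _) (mem_univ _) (mem_univ _),
    variationOnFromTo.eq_of_le _ _ hst, ENNReal.ofReal_toReal (hb _ _ (mem_univ _) (mem_univ _)),
    univ_inter]

lemma eVariationOn_Iic (h : length γ ≠ ⊤) (t : unitInterval) :
    eVariationOn γ (Iic t) = ENNReal.ofReal (arcPos γ t) := by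
  have := arcPos_sub h (unitInterval.nonneg' : (0 : unitInterval) ≤ t)
  rw [arcPos_zero, sub_zero] at this
  rw [this]
  congr 1
  ext s
  simp

lemma eVariationOn_Ici (h : length γ ≠ ⊤) (t : unitInterval) :
    eVariationOn γ (Ici t) = ENNReal.ofReal ((length γ).toReal - arcPos γ t) := by
  have := arcPos_sub h (unitInterval.le_one' : t ≤ 1)
  rw [arcPos_one] at this
  rw [this]
  congr 1
  ext s
  simp [unitInterval.le_one']

/-- A continuous path of bounded variation has no jump in its variation: the variation over a short
interval on either side of a point tends to zero. -/
lemma arcPos_continuous (h : length γ ≠ ⊤) : Continuous (arcPos γ) := by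
  have hb := boundedVariationOn_of_length_ne_top h
  rw [continuous_iff_continuousAt]
  intro t
  have hl : Tendsto (fun s => eVariationOn γ (univ ∩ Icc s t)) (𝓝[univ] t) (𝓝 0) :=
    hb.tendsto_eVariationOn_Icc_zero_left γ.continuous.continuousWithinAt
  have hr : Tendsto (fun s => eVariationOn γ (univ ∩ Icc t s)) (𝓝[univ] t) (𝓝 0) :=
    hb.tendsto_eVariationOn_Icc_zero_right t γ.continuous.continuousWithinAt
  rw [nhdsWithin_univ] at hl hr
  have hsum := hl.add hr
  rw [add_zero] at hsum
  rw [ContinuousAt, EMetric.tendsto_nhds]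
  intro ε hε
  filter_upwards [(tendsto_order.1 hsum).2 ε hε] with s hs
  refine lt_of_le_of_lt ?_ hs
  simp only [univ_inter]
  rcases le_total s t with hst | hst
  · refine le_trans ?_ le_self_add
    rw [← arcPos_sub h hst, edist_comm, edist_dist, Real.dist_eq,
      abs_of_nonneg (sub_nonneg.2 (arcPos_monotone h hst))]
  · refine le_trans ?_ le_add_self
    rw [← arcPos_sub h hst, edist_dist, Real.dist_eq,
      abs_of_nonneg (sub_nonneg.2 (arcPos_monotone h hst))]

lemma arcPos_image (h : length γ ≠ ⊤) : arcPos γ '' univ = Icc 0 (length γ).toReal := by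
  apply Subset.antisymm
  · rintro _ ⟨t, -, rfl⟩
    exact ⟨by rw [← arcPos_zero (γ := γ)]; exact arcPos_monotone h unitInterval.nonneg',
      by rw [← arcPos_one]; exact arcPos_monotone h unitInterval.le_one'⟩
  · intro s hs
    rw [← arcPos_one, ← arcPos_zero (γ := γ)] at hs
    obtain ⟨t, ht⟩ := mem_range_of_exists_le_of_exists_ge (arcPos_continuous h) ⟨0, hs.1⟩ ⟨1, hs.2⟩
    exact ⟨t, mem_univ _, ht⟩

lemma arcPos_mem (h : length γ ≠ ⊤) (t : unitInterval) :
    arcPos γ t ∈ Icc 0 (length γ).toReal := by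
  rw [← arcPos_image h]; exact ⟨t, mem_univ _, rfl⟩

lemma arcLengthParam_arcPos (h : length γ ≠ ⊤) (t : unitInterval) :
    arcLengthParam γ (arcPos γ t) = γ t :=
  edist_eq_zero.1 (edist_naturalParameterization_eq_zero
    (boundedVariationOn_of_length_ne_top h).locallyBoundedVariationOn (mem_univ _) (mem_univ t))

lemma arcLengthParam_zero (h : length γ ≠ ⊤) : arcLengthParam γ 0 = x := by
  rw [← arcPos_zero (γ := γ), arcLengthParam_arcPos h, γ.source]

lemma arcLengthParam_length (h : length γ ≠ ⊤) : arcLengthParam γ (length γ).toReal = y := by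
  rw [← arcPos_one, arcLengthParam_arcPos h, γ.target]

lemma arcLengthParam_lipschitz (h : length γ ≠ ⊤) :
    LipschitzOnWith 1 (arcLengthParam γ) (Icc 0 (length γ).toReal) := by
  have hu : HasUnitSpeedOn (arcLengthParam γ) (arcPos γ '' univ) :=
    has_unit_speed_naturalParameterization γ
      (boundedVariationOn_of_length_ne_top h).locallyBoundedVariationOn
      (mem_univ (0 : unitInterval))
  rw [arcPos_image h] at hu
  have key : ∀ s ∈ Icc 0 (length γ).toReal, ∀ t ∈ Icc 0 (length γ).toReal, s ≤ t →
      edist (arcLengthParam γ s) (arcLengthParam γ t) ≤ edist s t := by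
    intro s hs t ht hst
    have h1 := hu hs ht
    rw [NNReal.coe_one, one_mul] at h1
    calc _ ≤ eVariationOn (arcLengthParam γ) (Icc 0 (length γ).toReal ∩ Icc s t) :=
          eVariationOn.edist_le _ ⟨hs, le_rfl, hst⟩ ⟨ht, hst, le_rfl⟩
      _ = ENNReal.ofReal (t - s) := h1
      _ = edist s t := by
          rw [edist_comm, edist_dist, Real.dist_eq, abs_of_nonneg (sub_nonneg.2 hst)]
  intro s hs t ht
  rw [ENNReal.coe_one, one_mul]
  rcases le_total s t with hst | hst
  · exact key s hs t ht hst
  · rw [edist_comm, edist_comm s]; exact key t ht s hs hst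

end ArcLength

/-! ### Lipschitz curves -/

/-- The quasihyperbolic length of a curve parametrized on `[a, b]` with speed at most one. -/
noncomputable def qhInt (Ω : Set X) (h : ℝ → X) (a b : ℝ) : ℝ≥0∞ :=
  ∫⁻ s in Icc a b, (ENNReal.ofReal (bdryDist Ω (h s)))⁻¹

lemma qhLength_eq_qhInt (Ω : Set X) {x y : X} (γ : Path x y) :
    qhLength Ω γ = qhInt Ω (arcLengthParam γ) 0 (length γ).toReal := rfl

/-- A change of variables along a contraction onto an interval can only decrease an integral. -/
lemma lintegral_Icc_le_of_lipschitz {a b L : ℝ} {φ : ℝ → ℝ}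
    (hφ : LipschitzOnWith 1 φ (Icc a b)) (hsurj : Icc 0 L ⊆ φ '' Icc a b) (F : ℝ → ℝ≥0∞) :
    ∫⁻ u in Icc 0 L, F u ≤ ∫⁻ s in Icc a b, F (φ s) := by
  have hm : AEMeasurable φ (volume.restrict (Icc a b)) :=
    hφ.continuousOn.aemeasurable measurableSet_Icc
  refine le_trans (lintegral_mono' ?_ le_rfl) (lintegral_map_le F φ)
  -- The image of Lebesgue measure under `φ` dominates Lebesgue measure on the target, since a
  -- contraction does not increase one-dimensional Hausdorff measure and `φ` is onto. `F` need not
  -- be measurable.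
  refine Measure.le_iff.2 fun B hB => ?_
  rw [Measure.map_apply_of_aemeasurable hm hB, Measure.restrict_apply hB,
    Measure.restrict_apply' measurableSet_Icc]
  calc volume (B ∩ Icc 0 L) ≤ volume (φ '' (φ ⁻¹' B ∩ Icc a b)) := by
        refine measure_mono ?_
        rintro u ⟨huB, hu⟩
        obtain ⟨s, hs, rfl⟩ := hsurj hu
        exact ⟨s, ⟨huB, hs⟩, rfl⟩
    _ ≤ volume (φ ⁻¹' B ∩ Icc a b) := by
        have := (hφ.mono (inter_subset_right (s := φ ⁻¹' B))).hausdorffMeasure_image_le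
          (d := 1) zero_le_one
        simpa [hausdorffMeasure_real] using this

/-- A curve of speed at most one gives a rectifiable path that is no longer, also for the
quasihyperbolic length. -/
lemma exists_path_of_lipschitz {Ω : Set X} {h : ℝ → X} {a b : ℝ} (hab : a ≤ b)
    (hL : LipschitzOnWith 1 h (Icc a b)) (hΩ : ∀ s ∈ Icc a b, h s ∈ Ω) :
    ∃ γ : Path (h a) (h b), IsRectifiableIn Ω γ ∧ range γ = h '' Icc a b ∧
      qhLength Ω γ ≤ qhInt Ω h a b := by
  set p : unitInterval → ℝ := fun t => a + t * (b - a) with hp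
  have hpm : ∀ t, p t ∈ Icc a b := fun t => by
    have h1 := t.2.1
    have h2 := t.2.2
    constructor <;> simp only [hp] <;> nlinarith
  have hpc : Continuous p := by fun_prop
  let γ : Path (h a) (h b) :=
    { toFun := fun t => h (p t)
      continuous_toFun := by
        exact hL.continuousOn.comp_continuous hpc hpm
      source' := by simp [hp]
      target' := by simp [hp] }
  have hγ : ∀ t, γ t = h (p t) := fun t => rfl
  have hpmono : Monotone p := fun s t hst => by
    have : (s : ℝ) ≤ t := hst
    simp only [hp]; nlinarith
  have hvar : ∀ s t : unitInterval, eVariationOn γ (Icc s t) ≤ ENNReal.ofReal (p t - p s) := by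
    intro s t
    have e1 : eVariationOn γ (Icc s t) ≤ eVariationOn h (Icc (p s) (p t)) :=
      eVariationOn.comp_le_of_monotoneOn h p (hpmono.monotoneOn _)
        fun u hu => ⟨hpmono hu.1, hpmono hu.2⟩
    have e2 : eVariationOn h (Icc (p s) (p t)) ≤ (1 : NNReal) * eVariationOn id (Icc (p s) (p t)) :=
      (hL.mono (Icc_subset_Icc (hpm s).1 (hpm t).2)).comp_eVariationOn_le (mapsTo_id _)
    rw [eVariationOn_id_Icc, ENNReal.coe_one, one_mul] at e2
    exact e1.trans e2
  have hlen : length γ ≠ ⊤ := by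
    have h1 := hvar 0 1
    have : (Icc 0 1 : Set unitInterval) = univ := by ext t; simp [unitInterval.le_one']
    rw [this] at h1
    exact ne_top_of_le_ne_top ENNReal.ofReal_ne_top h1
  refine ⟨γ, ⟨fun t => hΩ _ (hpm t), hlen⟩, ?_, ?_⟩
  · apply Subset.antisymm
    · rintro _ ⟨t, rfl⟩
      exact ⟨p t, hpm t, rfl⟩
    · rintro _ ⟨s, hs, rfl⟩
      obtain ⟨t, ht⟩ := mem_range_of_exists_le_of_exists_ge hpc
        ⟨0, by simpa [hp] using hs.1⟩ ⟨1, by simpa [hp] using hs.2⟩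
      exact ⟨t, by rw [hγ, ht]⟩
  -- The inverse `q` of `p` below divides by `b - a`, so a degenerate interval is treated apart.
  rcases hab.eq_or_lt with rfl | hlt
  · have hconst : length γ = 0 := by
      have h1 := hvar 0 1
      have h2 : (Icc 0 1 : Set unitInterval) = univ := by ext t; simp [unitInterval.le_one']
      rw [h2] at h1
      simpa [hp, length] using h1
    rw [qhLength_eq_qhInt, hconst]
    simp [qhInt]
  set q : ℝ → unitInterval := fun s => projIcc 0 1 zero_le_one ((s - a) / (b - a)) with hq
  have hpq : ∀ s ∈ Icc a b, p (q s) = s := by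
    intro s hs
    have hba : 0 < b - a := sub_pos.2 hlt
    have h1 : (s - a) / (b - a) ∈ Icc (0 : ℝ) 1 :=
      ⟨div_nonneg (sub_nonneg.2 hs.1) hba.le, (div_le_one hba).2 (by linarith [hs.2])⟩
    simp only [hp, hq, projIcc_of_mem zero_le_one h1]
    field_simp
    ring
  have hqmono : Monotone q := fun s t hst => by
    apply monotone_projIcc
    have hba : 0 < b - a := sub_pos.2 hlt
    gcongr
  have hφ : LipschitzOnWith 1 (fun s => arcPos γ (q s)) (Icc a b) := by
    have key : ∀ s ∈ Icc a b, ∀ t ∈ Icc a b, s ≤ t →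
        edist (arcPos γ (q s)) (arcPos γ (q t)) ≤ edist s t := by
      intro s hs t ht hst
      rw [edist_comm, edist_dist, Real.dist_eq,
        abs_of_nonneg (sub_nonneg.2 (arcPos_monotone hlen (hqmono hst))),
        arcPos_sub hlen (hqmono hst), edist_comm, edist_dist, Real.dist_eq,
        abs_of_nonneg (sub_nonneg.2 hst)]
      have := hvar (q s) (q t)
      rwa [hpq s hs, hpq t ht] at this
    intro s hs t ht
    rw [ENNReal.coe_one, one_mul]
    rcases le_total s t with hst | hst
    · exact key s hs t ht hst
    · rw [edist_comm, edist_comm s]; exact key t ht s hs hst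
  have hpinj : Function.Injective p := fun s t hst => by
    have hba : b - a ≠ 0 := (sub_pos.2 hlt).ne'
    exact Subtype.ext (mul_right_cancel₀ hba (add_left_cancel hst))
  have hsurj : Icc 0 (length γ).toReal ⊆ (fun s => arcPos γ (q s)) '' Icc a b := by
    rw [← arcPos_image hlen]
    rintro _ ⟨t, -, rfl⟩
    refine ⟨p t, hpm t, ?_⟩
    have : q (p t) = t := hpinj (hpq _ (hpm t))
    simp only [this]
  rw [qhLength_eq_qhInt]
  refine (lintegral_Icc_le_of_lipschitz hφ hsurj _).trans_eq ?_
  refine setLIntegral_congr_fun measurableSet_Icc fun s hs => ?_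
  simp only [arcLengthParam_arcPos hlen, hγ, hpq s hs]

/-- `Ω` is a proper subdomain of a length space and `(Ω, k_Ω)` is geodesic. -/
structure IsGeodesicSubdomain (Ω : Set X) : Prop where
  lengthSpace : IsLengthSpace X
  subdomain : IsProperSubdomain Ω
  geodesic : IsQHGeodesicDomain Ω

/-- `h` is a curve in `Ω` of speed at most one on the interval `[a, b]`. -/
structure IsCurve (Ω : Set X) (h : ℝ → X) (a b : ℝ) : Prop where
  le : a ≤ b
  dist_le : ∀ s t, a ≤ s → s ≤ t → t ≤ b → dist (h s) (h t) ≤ t - s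
  mem : ∀ s, a ≤ s → s ≤ b → h s ∈ Ω

/-- A quasihyperbolic geodesic with speed at most one on the interval `[a, b]`. -/
structure IsGeod (Ω : Set X) (g : ℝ → X) (a b : ℝ) : Prop extends IsCurve Ω g a b where
  eq : qhDist Ω (g a) (g b) = qhInt Ω g a b

variable {Ω : Set X}

/-! ### The distance to the boundary -/

lemma bdryDist_nonneg (Ω : Set X) (z : X) : 0 ≤ bdryDist Ω z := Metric.infDist_nonneg

lemma bdryDist_le_add (Ω : Set X) (z w : X) : bdryDist Ω z ≤ bdryDist Ω w + dist z w :=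
  Metric.infDist_le_infDist_add_dist

lemma bdryDist_continuous (Ω : Set X) : Continuous (bdryDist Ω) := Metric.continuous_infDist_pt _

lemma IsLengthSpace.preconnectedSpace (hX : IsLengthSpace X) : PreconnectedSpace X := by
  refine ⟨isPreconnected_of_forall_pair fun x _ y _ => ?_⟩
  obtain ⟨γ, -⟩ := hX x y 1 one_pos
  exact ⟨range γ, subset_univ _, ⟨0, γ.source⟩, ⟨1, γ.target⟩, isPreconnected_range γ.continuous⟩

lemma IsGeodesicSubdomain.frontier_nonempty (h : IsGeodesicSubdomain Ω) :
    (frontier Ω).Nonempty := by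
  have := h.lengthSpace.preconnectedSpace
  exact nonempty_frontier_iff.2 ⟨h.subdomain.2.1.nonempty, h.subdomain.2.2⟩

lemma IsGeodesicSubdomain.bdryDist_pos (h : IsGeodesicSubdomain Ω) {z : X} (hz : z ∈ Ω) :
    0 < bdryDist Ω z := by
  refine (isClosed_frontier.notMem_iff_infDist_pos h.frontier_nonempty).1 fun hf => ?_
  exact disjoint_left.1 (disjoint_frontier_iff_isOpen.2 h.subdomain.1) hf hz

/-- Off the frontier the space splits into the disjoint open sets `Ω` and the complement of its
closure; a preconnected set stays in one of them. -/
lemma subset_of_isPreconnected_of_disjoint_frontier (hΩ : IsOpen Ω) {S : Set X}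
    (hS : IsPreconnected S) {z : X} (hzS : z ∈ S) (hz : z ∈ Ω) (hd : ∀ w ∈ S, w ∉ frontier Ω) :
    S ⊆ Ω := by
  refine hS.subset_left_of_subset_union hΩ isClosed_closure.isOpen_compl
    (disjoint_compl_right.mono_left subset_closure |>.mono_right le_rfl) ?_ ⟨z, hzS, hz⟩
  intro w hw
  by_cases hc : w ∈ closure Ω
  · left
    by_contra hn
    exact hd w hw ⟨hc, by rwa [hΩ.interior_eq]⟩
  · exact Or.inr hc

lemma notMem_frontier_of_dist_lt {z w : X} (h : dist z w < bdryDist Ω z) : w ∉ frontier Ω :=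
  fun hw => absurd (Metric.infDist_le_dist_of_mem hw) (not_le.2 h)

/-! ### Curves of speed at most one -/

lemma IsCurve.lipschitzOnWith {h : ℝ → X} {a b : ℝ} (hc : IsCurve Ω h a b) :
    LipschitzOnWith 1 h (Icc a b) := by
  refine LipschitzOnWith.of_dist_le_mul fun s hs t ht => ?_
  rw [NNReal.coe_one, one_mul]
  rcases le_total s t with hst | hst
  · rw [dist_comm s, Real.dist_eq, abs_of_nonneg (sub_nonneg.2 hst)]
    exact hc.dist_le s t hs.1 hst ht.2
  · rw [Real.dist_eq, abs_of_nonneg (sub_nonneg.2 hst), dist_comm]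
    exact hc.dist_le t s ht.1 hst hs.2

lemma IsCurve.continuousOn {h : ℝ → X} {a b : ℝ} (hc : IsCurve Ω h a b) :
    ContinuousOn h (Icc a b) := hc.lipschitzOnWith.continuousOn

lemma IsCurve.sub {h : ℝ → X} {a b s t : ℝ} (hc : IsCurve Ω h a b) (has : a ≤ s) (hst : s ≤ t)
    (htb : t ≤ b) : IsCurve Ω h s t where
  le := hst
  dist_le u v hu huv hv := hc.dist_le u v (has.trans hu) huv (hv.trans htb)
  mem u hu hv := hc.mem u (has.trans hu) (hv.trans htb)

lemma IsCurve.reverse {h : ℝ → X} {a b : ℝ} (hc : IsCurve Ω h a b) (c : ℝ) :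
    IsCurve Ω (fun s => h (c - s)) (c - b) (c - a) where
  le := by linarith [hc.le]
  dist_le u v hu huv hv := by
    rw [dist_comm]
    exact (hc.dist_le (c - v) (c - u) (by linarith) (by linarith) (by linarith)).trans_eq (by ring)
  mem u hu hv := hc.mem _ (by linarith) (by linarith)

lemma IsCurve.concat {h₁ h₂ : ℝ → X} {a b c : ℝ} (hc₁ : IsCurve Ω h₁ a b) (hc₂ : IsCurve Ω h₂ b c)
    (h : h₁ b = h₂ b) : IsCurve Ω (fun s => if s ≤ b then h₁ s else h₂ s) a c where
  le := hc₁.le.trans hc₂.le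
  dist_le s t hs hst ht := by
    by_cases htb : t ≤ b
    · simp only [if_pos htb, if_pos (hst.trans htb)]
      exact hc₁.dist_le s t hs hst htb
    · have hbt := (not_le.1 htb).le
      by_cases hsb : s ≤ b
      · simp only [if_neg htb, if_pos hsb]
        have e1 := hc₁.dist_le s b hs hsb le_rfl
        have e2 := hc₂.dist_le b t le_rfl hbt ht
        have e3 := dist_triangle (h₁ s) (h₁ b) (h₂ t)
        rw [h] at e1 e3
        linarith
      · simp only [if_neg htb, if_neg hsb]
        exact hc₂.dist_le s t (not_le.1 hsb).le hst ht
  mem s hs hsc := by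
    by_cases hsb : s ≤ b
    · simp only [if_pos hsb]; exact hc₁.mem s hs hsb
    · simp only [if_neg hsb]; exact hc₂.mem s (not_le.1 hsb).le hsc

lemma isCurve_arcLengthParam {x y : X} {γ : Path x y} (hγ : IsRectifiableIn Ω γ) :
    IsCurve Ω (arcLengthParam γ) 0 (length γ).toReal where
  le := ENNReal.toReal_nonneg
  dist_le s t hs hst ht := by
    have := (arcLengthParam_lipschitz hγ.2).dist_le_mul s ⟨hs, hst.trans ht⟩ t ⟨hs.trans hst, ht⟩
    rwa [NNReal.coe_one, one_mul, dist_comm s, Real.dist_eq, abs_of_nonneg (sub_nonneg.2 hst)]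
      at this
  mem s hs ht := by
    have : s ∈ arcPos γ '' univ := by rw [arcPos_image hγ.2]; exact ⟨hs, ht⟩
    obtain ⟨t, -, rfl⟩ := this
    rw [arcLengthParam_arcPos hγ.2]
    exact hγ.1 t

lemma IsCurve.qhDist_le {h : ℝ → X} {a b : ℝ} (hc : IsCurve Ω h a b) :
    qhDist Ω (h a) (h b) ≤ qhInt Ω h a b := by
  obtain ⟨γ, hγ, -, hle⟩ := exists_path_of_lipschitz hc.le hc.lipschitzOnWith
    fun s hs => hc.mem s hs.1 hs.2
  exact (iInf₂_le γ hγ).trans hle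

lemma qhInt_congr {h₁ h₂ : ℝ → X} {a b : ℝ} (h : ∀ s, a ≤ s → s ≤ b → h₁ s = h₂ s) :
    qhInt Ω h₁ a b = qhInt Ω h₂ a b :=
  setLIntegral_congr_fun measurableSet_Icc fun s hs => by simp only [h s hs.1 hs.2]

lemma qhInt_add (h : ℝ → X) {a b c : ℝ} (hab : a ≤ b) (hbc : b ≤ c) :
    qhInt Ω h a b + qhInt Ω h b c = qhInt Ω h a c := by
  unfold qhInt
  rw [← setLIntegral_congr (Ioc_ae_eq_Icc (a := b) (b := c)),
    ← lintegral_union measurableSet_Ioc, Icc_union_Ioc_eq_Icc hab hbc]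
  exact disjoint_left.2 fun s hs hs' => absurd hs'.1 (not_lt.2 hs.2)

lemma qhInt_reverse (h : ℝ → X) (a b c : ℝ) :
    qhInt Ω (fun s => h (c - s)) (c - b) (c - a) = qhInt Ω h a b := by
  unfold qhInt
  have hm : MeasurePreserving (fun s : ℝ => c - s) volume volume :=
    Measure.measurePreserving_sub_left volume c
  have he : MeasurableEmbedding (fun s : ℝ => c - s) :=
    (MeasurableEquiv.subLeft c).measurableEmbedding
  have := hm.setLIntegral_comp_preimage_emb he
    (fun s => (ENNReal.ofReal (bdryDist Ω (h s)))⁻¹) (Icc a b)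
  rw [← this]
  congr 2
  ext s
  simp only [mem_Icc, mem_preimage]
  constructor <;> rintro ⟨h1, h2⟩ <;> constructor <;> linarith

/-! ### Estimates for the quasihyperbolic length -/

lemma qhInt_le_of_le (h : ℝ → X) {a b c : ℝ} (hc : 0 < c)
    (hd : ∀ s, a ≤ s → s ≤ b → c ≤ bdryDist Ω (h s)) :
    qhInt Ω h a b ≤ ENNReal.ofReal ((b - a) / c) := by
  calc qhInt Ω h a b ≤ ∫⁻ _ in Icc a b, (ENNReal.ofReal c)⁻¹ := by
        refine setLIntegral_mono' measurableSet_Icc fun s hs => ?_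
        exact ENNReal.inv_le_inv.2 (ENNReal.ofReal_le_ofReal (hd s hs.1 hs.2))
    _ = ENNReal.ofReal ((b - a) / c) := by
        rw [setLIntegral_const, Real.volume_Icc, ← ENNReal.ofReal_inv_of_pos hc,
          ← ENNReal.ofReal_mul (inv_nonneg.2 hc.le), div_eq_inv_mul]

lemma lintegral_inv_add {a b e : ℝ} (hab : a ≤ b) (he : 0 < a + e) :
    ∫⁻ s in Icc a b, ENNReal.ofReal (s + e)⁻¹ = ENNReal.ofReal (Real.log ((b + e) / (a + e))) := by
  have hcont : ContinuousOn (fun s : ℝ => (s + e)⁻¹) (Icc a b) :=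
    ContinuousOn.inv₀ (by fun_prop) fun s hs => by linarith [hs.1]
  have hint : IntegrableOn (fun s : ℝ => (s + e)⁻¹) (Icc a b) :=
    hcont.integrableOn_Icc
  rw [← ofReal_integral_eq_lintegral_ofReal hint]
  · congr 1
    rw [integral_Icc_eq_integral_Ioc, ← intervalIntegral.integral_of_le hab,
      intervalIntegral.integral_comp_add_right (fun s : ℝ => s⁻¹),
      integral_inv_of_pos he (by linarith)]
  · refine (ae_restrict_iff' measurableSet_Icc).2 (Eventually.of_forall fun s hs => ?_)
    exact inv_nonneg.2 (by linarith [hs.1])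

lemma qhInt_le_log (h : ℝ → X) {a b M : ℝ} (ha : 0 < a) (hab : a ≤ b) (hM : 0 < M)
    (hd : ∀ s, a ≤ s → s ≤ b → s ≤ M * bdryDist Ω (h s)) :
    qhInt Ω h a b ≤ ENNReal.ofReal (M * Real.log (b / a)) := by
  calc qhInt Ω h a b ≤ ∫⁻ s in Icc a b, ENNReal.ofReal M * ENNReal.ofReal (s + 0)⁻¹ := by
        refine setLIntegral_mono' measurableSet_Icc fun s hs => ?_
        have hs0 : 0 < s := ha.trans_le hs.1
        have h1 := hd s hs.1 hs.2
        have h2 : 0 < bdryDist Ω (h s) := by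
          by_contra hn
          nlinarith
        rw [add_zero, ← ENNReal.ofReal_mul hM.le, ← ENNReal.ofReal_inv_of_pos h2]
        apply ENNReal.ofReal_le_ofReal
        rw [← div_eq_mul_inv, inv_eq_one_div, div_le_div_iff₀ h2 hs0]
        linarith
    _ = ENNReal.ofReal (M * Real.log (b / a)) := by
        rw [lintegral_const_mul' _ _ ENNReal.ofReal_ne_top, lintegral_inv_add hab (by linarith),
          ← ENNReal.ofReal_mul hM.le, add_zero, add_zero]

/-- The boundary distance is 1-Lipschitz, so at parameter `s` it is at most `bdryDist Ω (h a) + (s -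
a)`; integrate the reciprocal. -/
lemma IsCurve.log_le_qhInt {h : ℝ → X} {a b : ℝ} (hc : IsCurve Ω h a b)
    (hd : ∀ s, a ≤ s → s ≤ b → 0 < bdryDist Ω (h s)) :
    ENNReal.ofReal (Real.log ((bdryDist Ω (h a) + (b - a)) / bdryDist Ω (h a))) ≤
      qhInt Ω h a b := by
  have h0 := hd a le_rfl hc.le
  have := lintegral_inv_add (e := bdryDist Ω (h a) - a) hc.le (by linarith)
  rw [show b + (bdryDist Ω (h a) - a) = bdryDist Ω (h a) + (b - a) by ring,
    show a + (bdryDist Ω (h a) - a) = bdryDist Ω (h a) by ring] at this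
  rw [← this]
  refine setLIntegral_mono' measurableSet_Icc fun s hs => ?_
  rw [← ENNReal.ofReal_inv_of_pos (hd s hs.1 hs.2)]
  apply ENNReal.ofReal_le_ofReal
  apply inv_anti₀ (hd s hs.1 hs.2)
  have e1 := bdryDist_le_add Ω (h s) (h a)
  have e2 := hc.dist_le a s le_rfl hs.1 hs.2
  rw [dist_comm] at e2
  linarith

lemma IsGeodesicSubdomain.qhInt_ne_top (hD : IsGeodesicSubdomain Ω) {h : ℝ → X} {a b : ℝ}
    (hc : IsCurve Ω h a b) : qhInt Ω h a b ≠ ⊤ := by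
  obtain ⟨s, hs, hmin⟩ := isCompact_Icc.exists_isMinOn (nonempty_Icc.2 hc.le)
    ((bdryDist_continuous Ω).comp_continuousOn hc.continuousOn)
  exact ne_top_of_le_ne_top ENNReal.ofReal_ne_top
    (qhInt_le_of_le h (hD.bdryDist_pos (hc.mem s hs.1 hs.2)) fun t h1 h2 => hmin ⟨h1, h2⟩)

/-! ### The quasihyperbolic distance -/

lemma IsGeodesicSubdomain.exists_isGeod (hD : IsGeodesicSubdomain Ω) {x y : X} (hx : x ∈ Ω)
    (hy : y ∈ Ω) : ∃ g L, IsGeod Ω g 0 L ∧ g 0 = x ∧ g L = y := by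
  obtain ⟨γ, hγ, he⟩ := hD.geodesic x hx y hy
  refine ⟨arcLengthParam γ, (length γ).toReal, ⟨isCurve_arcLengthParam hγ, ?_⟩,
    arcLengthParam_zero hγ.2, arcLengthParam_length hγ.2⟩
  rw [arcLengthParam_zero hγ.2, arcLengthParam_length hγ.2, ← qhLength_eq_qhInt, he]

lemma isGeod_arcLengthParam {x y : X} {γ : Path x y} (hγ : IsQHGeodesic Ω γ) :
    IsGeod Ω (arcLengthParam γ) 0 (length γ).toReal where
  toIsCurve := isCurve_arcLengthParam hγ.1
  eq := by
    rw [arcLengthParam_zero hγ.1.2, arcLengthParam_length hγ.1.2, ← qhLength_eq_qhInt, hγ.2]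

lemma IsGeodesicSubdomain.qhDist_ne_top (hD : IsGeodesicSubdomain Ω) {x y : X} (hx : x ∈ Ω)
    (hy : y ∈ Ω) : qhDist Ω x y ≠ ⊤ := by
  obtain ⟨g, L, hg, rfl, rfl⟩ := hD.exists_isGeod hx hy
  rw [hg.eq]
  exact hD.qhInt_ne_top hg.toIsCurve

lemma IsGeodesicSubdomain.qhDist_triangle (hD : IsGeodesicSubdomain Ω) {x y z : X} (hx : x ∈ Ω)
    (hy : y ∈ Ω) (hz : z ∈ Ω) : qhDist Ω x z ≤ qhDist Ω x y + qhDist Ω y z := by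
  obtain ⟨g₂, L₂, h₂, e3, e4⟩ := hD.exists_isGeod hy hz
  obtain ⟨g₃, L₃, h₃, e5, e6⟩ := hD.exists_isGeod hx hy
  -- Reversing twice translates the parameter, so that `g₂` starts where `g₃` stops.
  have hc2 := (h₂.toIsCurve.reverse 0).reverse L₃
  have hs : (fun s => (fun s => g₂ (0 - s)) (L₃ - s)) = fun s => g₂ (s - L₃) := by
    ext s; ring_nf
  rw [hs, show L₃ - (0 - 0) = L₃ by ring, show L₃ - (0 - L₂) = L₃ + L₂ by ring] at hc2
  have hc := h₃.toIsCurve.concat hc2 (by simp [e3, e6])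
  have hle := hc.qhDist_le
  rw [← qhInt_add _ h₃.le hc2.le] at hle
  have i1 : qhInt Ω (fun s => if s ≤ L₃ then g₃ s else g₂ (s - L₃)) 0 L₃ = qhDist Ω x y := by
    rw [qhInt_congr (h₂ := g₃) fun s _ hs => if_pos hs, ← h₃.eq, e5, e6]
  have i2 : qhInt Ω (fun s => if s ≤ L₃ then g₃ s else g₂ (s - L₃)) L₃ (L₃ + L₂) =
      qhDist Ω y z := by
    rw [qhInt_congr (h₂ := fun s => g₂ (s - L₃))]
    · have r1 := qhInt_reverse (Ω := Ω) (fun s => g₂ (0 - s)) (0 - L₂) (0 - 0) L₃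
      rw [hs, qhInt_reverse, show L₃ - (0 - 0) = L₃ by ring,
        show L₃ - (0 - L₂) = L₃ + L₂ by ring] at r1
      rw [r1, ← h₂.eq, e3, e4]
    · intro s hs _
      rcases hs.eq_or_lt with rfl | hlt
      · simp [e3, e6]
      · exact if_neg (not_le.2 hlt)
  rw [i1, i2] at hle
  have s1 : (0 : ℝ) ≤ L₃ := h₃.le
  simp only [if_pos s1, e5] at hle
  rcases h₂.le.eq_or_lt with h0 | hlt
  · have hyz : y = z := by rw [← e3, h0, e4]
    subst hyz
    rwa [← h0, add_zero, if_pos le_rfl, e6] at hle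
  · rwa [if_neg (by linarith), add_sub_cancel_left, e4] at hle

lemma IsGeod.reverse {g : ℝ → X} {a b : ℝ} (hg : IsGeod Ω g a b) (c : ℝ)
    (hs : qhDist Ω (g b) (g a) = qhDist Ω (g a) (g b)) :
    IsGeod Ω (fun s => g (c - s)) (c - b) (c - a) where
  toIsCurve := hg.toIsCurve.reverse c
  eq := by rw [qhInt_reverse, ← hg.eq, sub_sub_cancel, sub_sub_cancel, hs]

lemma IsGeodesicSubdomain.qhDist_comm (hD : IsGeodesicSubdomain Ω) {x y : X} (hx : x ∈ Ω)
    (hy : y ∈ Ω) : qhDist Ω x y = qhDist Ω y x := by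
  have key : ∀ {x y : X}, x ∈ Ω → y ∈ Ω → qhDist Ω x y ≤ qhDist Ω y x := by
    intro x y hx hy
    obtain ⟨g, L, hg, e1, e2⟩ := hD.exists_isGeod hy hx
    have := (hg.toIsCurve.reverse 0).qhDist_le
    rw [qhInt_reverse, ← hg.eq] at this
    simpa [e1, e2] using this
  exact le_antisymm (key hx hy) (key hy hx)

/-- The quasihyperbolic distance as a real number. -/
noncomputable def qhd (Ω : Set X) (x y : X) : ℝ := (qhDist Ω x y).toReal

lemma qhd_nonneg (Ω : Set X) (x y : X) : 0 ≤ qhd Ω x y := ENNReal.toReal_nonneg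

lemma IsCurve.qhd_le_of_le {h : ℝ → X} {a b c : ℝ} (hh : IsCurve Ω h a b) (hc : 0 < c)
    (hd : ∀ s, a ≤ s → s ≤ b → c ≤ bdryDist Ω (h s)) :
    qhd Ω (h a) (h b) ≤ (b - a) / c :=
  ENNReal.toReal_le_of_le_ofReal (div_nonneg (sub_nonneg.2 hh.le) hc.le)
    (hh.qhDist_le.trans (qhInt_le_of_le h hc hd))

lemma IsCurve.qhd_le_log {h : ℝ → X} {a b M : ℝ} (hh : IsCurve Ω h a b) (ha : 0 < a) (hM : 0 < M)
    (hd : ∀ s, a ≤ s → s ≤ b → s ≤ M * bdryDist Ω (h s)) :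
    qhd Ω (h a) (h b) ≤ M * Real.log (b / a) :=
  ENNReal.toReal_le_of_le_ofReal
    (mul_nonneg hM.le (Real.log_nonneg ((one_le_div ha).2 hh.le)))
    (hh.qhDist_le.trans (qhInt_le_log h ha hh.le hM hd))

namespace IsGeodesicSubdomain

variable (hD : IsGeodesicSubdomain Ω)
include hD

lemma qhd_comm {x y : X} (hx : x ∈ Ω) (hy : y ∈ Ω) : qhd Ω x y = qhd Ω y x := by
  rw [qhd, hD.qhDist_comm hx hy, qhd]

lemma qhd_triangle {x y z : X} (hx : x ∈ Ω) (hy : y ∈ Ω) (hz : z ∈ Ω) :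
    qhd Ω x z ≤ qhd Ω x y + qhd Ω y z := by
  unfold qhd
  rw [← ENNReal.toReal_add (hD.qhDist_ne_top hx hy) (hD.qhDist_ne_top hy hz)]
  exact ENNReal.toReal_mono (ENNReal.add_ne_top.2
    ⟨hD.qhDist_ne_top hx hy, hD.qhDist_ne_top hy hz⟩) (hD.qhDist_triangle hx hy hz)

/-- The triangle inequality through the two cut points is squeezed between equal totals. The outer
pieces have finite quasihyperbolic length, so they cancel. -/
lemma isGeod_sub {g : ℝ → X} {a b s t : ℝ} (hg : IsGeod Ω g a b) (has : a ≤ s) (hst : s ≤ t)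
    (htb : t ≤ b) : IsGeod Ω g s t where
  toIsCurve := hg.toIsCurve.sub has hst htb
  eq := by
    have ca := hg.toIsCurve.sub le_rfl has (hst.trans htb)
    have cm := hg.toIsCurve.sub has hst htb
    have cb := hg.toIsCurve.sub (has.trans hst) htb le_rfl
    refine le_antisymm cm.qhDist_le ?_
    have ha := hg.mem a le_rfl hg.le
    have hb := hg.mem b hg.le le_rfl
    have hs := cm.mem s le_rfl hst
    have ht := cm.mem t hst le_rfl
    have h1 := hD.qhDist_triangle ha hs hb
    have h2 := hD.qhDist_triangle hs ht hb
    rw [hg.eq, ← qhInt_add g has (hst.trans htb), ← qhInt_add g hst htb] at h1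
    have h3 : qhInt Ω g a s + (qhInt Ω g s t + qhInt Ω g t b) ≤
        qhInt Ω g a s + (qhDist Ω (g s) (g t) + qhInt Ω g t b) :=
      h1.trans (add_le_add ca.qhDist_le (h2.trans (add_le_add le_rfl cb.qhDist_le)))
    exact (ENNReal.add_le_add_iff_right (hD.qhInt_ne_top cb)).1
      ((ENNReal.add_le_add_iff_left (hD.qhInt_ne_top ca)).1 h3)

lemma isGeod_reverse {g : ℝ → X} {a b : ℝ} (hg : IsGeod Ω g a b) (c : ℝ) :
    IsGeod Ω (fun s => g (c - s)) (c - b) (c - a) :=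
  hg.reverse c (hD.qhDist_comm (hg.mem b hg.le le_rfl) (hg.mem a le_rfl hg.le))

lemma qhd_add {g : ℝ → X} {a b s : ℝ} (hg : IsGeod Ω g a b) (has : a ≤ s) (hsb : s ≤ b) :
    qhd Ω (g a) (g s) + qhd Ω (g s) (g b) = qhd Ω (g a) (g b) := by
  have h1 := hD.isGeod_sub hg le_rfl has hsb
  have h2 := hD.isGeod_sub hg has hsb le_rfl
  unfold qhd
  rw [hg.eq, h1.eq, h2.eq, ← qhInt_add g has hsb, ENNReal.toReal_add (hD.qhInt_ne_top h1.toIsCurve)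
    (hD.qhInt_ne_top h2.toIsCurve)]

/-- The length of a quasihyperbolic geodesic is controlled by its quasihyperbolic length. -/
lemma sub_le_mul_exp {g : ℝ → X} {a b : ℝ} (hg : IsGeod Ω g a b) :
    bdryDist Ω (g a) + (b - a) ≤ bdryDist Ω (g a) * Real.exp (qhd Ω (g a) (g b)) := by
  have hd : ∀ s, a ≤ s → s ≤ b → 0 < bdryDist Ω (g s) := fun s h1 h2 =>
    hD.bdryDist_pos (hg.mem s h1 h2)
  have h0 := hd a le_rfl hg.le
  have h1 := hg.toIsCurve.log_le_qhInt hd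
  rw [← hg.eq, ENNReal.ofReal_le_iff_le_toReal
    (hD.qhDist_ne_top (hg.mem a le_rfl hg.le) (hg.mem b hg.le le_rfl))] at h1
  have h2 := (Real.log_le_iff_le_exp (div_pos (by linarith [hg.le]) h0)).1 h1
  rw [div_le_iff₀ h0] at h2
  rw [mul_comm]
  exact h2

lemma bdryDist_le_mul_exp {x y : X} (hx : x ∈ Ω) (hy : y ∈ Ω) :
    bdryDist Ω y ≤ bdryDist Ω x * Real.exp (qhd Ω x y) := by
  obtain ⟨g, L, hg, rfl, rfl⟩ := hD.exists_isGeod hx hy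
  refine le_trans ?_ (hD.sub_le_mul_exp hg)
  have := hg.dist_le 0 L le_rfl hg.le le_rfl
  have h2 := bdryDist_le_add Ω (g L) (g 0)
  rw [dist_comm] at h2
  linarith

/-- A curve from `x` shorter than the distance to the frontier cannot leave `Ω`; the length space
supplies one. -/
lemma exists_isCurve_of_dist_lt {x y : X} (hx : x ∈ Ω) {ρ : ℝ} (hρ : dist x y < ρ)
    (hρd : ρ < bdryDist Ω x) : ∃ h L, IsCurve Ω h 0 L ∧ h 0 = x ∧ h L = y ∧ L ≤ ρ := by
  obtain ⟨γ, hγ⟩ := hD.lengthSpace x y (ρ - dist x y) (sub_pos.2 hρ)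
  have hρ0 : 0 ≤ ρ := dist_nonneg.trans hρ.le
  rw [add_sub_cancel] at hγ
  have hlen : length γ ≠ ⊤ := ne_top_of_le_ne_top ENNReal.ofReal_ne_top hγ
  have hclose : ∀ t, dist x (γ t) ≤ ρ := by
    intro t
    have h1 : edist (γ 0) (γ t) ≤ eVariationOn γ univ :=
      eVariationOn.edist_le _ (mem_univ _) (mem_univ _)
    rw [γ.source, edist_dist] at h1
    exact (ENNReal.ofReal_le_ofReal_iff hρ0).1 (h1.trans hγ)
  have hΩ : range γ ⊆ Ω := by
    refine subset_of_isPreconnected_of_disjoint_frontier hD.subdomain.1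
      (isPreconnected_range γ.continuous) ⟨0, γ.source⟩ hx ?_
    rintro _ ⟨t, rfl⟩
    exact notMem_frontier_of_dist_lt ((hclose t).trans_lt hρd)
  refine ⟨arcLengthParam γ, (length γ).toReal,
    isCurve_arcLengthParam ⟨fun t => hΩ ⟨t, rfl⟩, hlen⟩, arcLengthParam_zero hlen,
    arcLengthParam_length hlen, ENNReal.toReal_le_of_le_ofReal hρ0 hγ⟩

lemma qhd_le_of_dist_lt {x y : X} (hx : x ∈ Ω) (hxy : dist x y < bdryDist Ω x / 2) :
    qhd Ω x y ≤ 2 * dist x y / bdryDist Ω x := by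
  have hpos := hD.bdryDist_pos hx
  have key : ∀ ρ, dist x y < ρ → ρ < bdryDist Ω x / 2 → qhd Ω x y ≤ 2 * ρ / bdryDist Ω x := by
    intro ρ h1 h2
    obtain ⟨h, L, hc, rfl, rfl, hL⟩ := hD.exists_isCurve_of_dist_lt hx h1 (by linarith)
    have := hc.qhd_le_of_le (half_pos hpos) (fun s h3 h4 => by
      have e1 := hc.dist_le 0 s le_rfl h3 h4
      have e2 := bdryDist_le_add Ω (h 0) (h s)
      linarith)
    refine this.trans ?_
    rw [div_le_div_iff₀ (half_pos hpos) hpos]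
    nlinarith
  have hlim : Tendsto (fun ρ : ℝ => 2 * ρ / bdryDist Ω x) (𝓝[>] dist x y)
      (𝓝 (2 * dist x y / bdryDist Ω x)) := by
    apply tendsto_nhdsWithin_of_tendsto_nhds
    exact (Continuous.tendsto (by fun_prop) _)
  refine ge_of_tendsto hlim ?_
  filter_upwards [Ioo_mem_nhdsGT hxy] with ρ hρ
  exact key ρ hρ.1 hρ.2

lemma qhd_lt_one {x y : X} (hx : x ∈ Ω) (h : dist x y < bdryDist Ω x / 2) : qhd Ω x y < 1 := by
  refine (hD.qhd_le_of_dist_lt hx h).trans_lt ?_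
  rw [div_lt_one (hD.bdryDist_pos hx)]
  linarith

lemma qhd_self {x : X} (hx : x ∈ Ω) : qhd Ω x x = 0 := by
  have h := hD.qhd_le_of_dist_lt hx (by rw [dist_self]; exact half_pos (hD.bdryDist_pos hx))
  rw [dist_self, mul_zero, zero_div] at h
  exact le_antisymm h (qhd_nonneg _ _ _)

end IsGeodesicSubdomain

/-! ### The diameter cigar condition -/

/-- Every point `w` of a quasihyperbolic geodesic is at distance at most `A d_Ω(w)` from one of
its end points. -/
def DiamCigar (Ω : Set X) (A : ℝ) : Prop :=
  ∀ (g : ℝ → X) (a b w : ℝ), IsGeod Ω g a b → a ≤ w → w ≤ b →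
    min (dist (g a) (g w)) (dist (g b) (g w)) ≤ A * bdryDist Ω (g w)

lemma IsGeod.exists_path {g : ℝ → X} {a b : ℝ} (hg : IsGeod Ω g a b) :
    ∃ γ : Path (g a) (g b), IsQHGeodesic Ω γ ∧ range γ = g '' Icc a b := by
  obtain ⟨γ, hγ, hr, hle⟩ := exists_path_of_lipschitz hg.le hg.lipschitzOnWith
    fun s hs => hg.mem s hs.1 hs.2
  rw [← hg.eq] at hle
  exact ⟨γ, ⟨hγ, le_antisymm hle (iInf₂_le γ hγ)⟩, hr⟩

lemma edist_le_innerDist (Ω : Set X) (x y : X) : edist x y ≤ innerDist Ω x y := by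
  refine le_iInf₂ fun γ _ => ?_
  have h1 : edist (γ 0) (γ 1) ≤ eVariationOn γ univ :=
    eVariationOn.edist_le _ (mem_univ _) (mem_univ _)
  rwa [γ.source, γ.target] at h1

/-- With `r` strictly between the two sides of the failed inequality, LLC-2 gives a curve outside
`B(g w, r / c₀)`. This ball contains the separating inner ball, because the inner distance dominates
the distance. -/
lemma diamCigar_of_ballSeparation {c₀ C : ℝ} (hc₀ : 0 < c₀) (hC : 0 < C) (hLLC : IsLLC2 Ω c₀)
    (hsep : BallSeparation Ω C) : DiamCigar Ω (c₀ * C) := by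
  intro g a b w hg haw hwb
  by_contra hlt
  obtain ⟨r, hr1, hr2⟩ := exists_between (not_le.1 hlt)
  have hr0 : 0 < r := lt_of_le_of_lt (by have := bdryDist_nonneg Ω (g w); positivity) hr1
  obtain ⟨hra, hrb⟩ := lt_min_iff.1 hr2
  obtain ⟨γ, hγ, hrange⟩ := hg.exists_path
  have hout : ∀ p, r < dist p (g w) → p ∉ closure (Metric.ball (g w) r) := fun p hp hcl =>
    absurd (Metric.closure_ball_subset_closedBall hcl) (by simpa using hp)
  have ha := hg.mem a le_rfl hg.le
  have hb := hg.mem b hg.le le_rfl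
  obtain ⟨α, hα⟩ := hLLC (g w) (hg.mem w haw hwb) r hr0 (g a) ⟨ha, hout _ hra⟩ (g b)
    ⟨hb, hout _ hrb⟩
  obtain ⟨p, hp, t, rfl⟩ := hsep (g a) ha (g b) hb γ hγ (g w) (hrange ▸ ⟨w, ⟨haw, hwb⟩, rfl⟩) α
    fun t => (hα t).1
  have h1 : r / c₀ ≤ dist (α t) (g w) := by
    by_contra hn
    exact (hα t).2 (subset_closure (Metric.mem_ball.2 (not_le.1 hn)))
  have h2 := (edist_le_innerDist Ω (g w) (α t)).trans_lt hp.2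
  rw [edist_comm, edist_dist] at h2
  have h3 := (ENNReal.ofReal_lt_ofReal_iff_of_nonneg dist_nonneg).1 h2
  have h4 := h1.trans_lt h3
  rw [div_lt_iff₀ hc₀] at h4
  linarith

/-- Run a geodesic towards the boundary. A point `w` at half the end point distance from its last
point has boundary distance at most that half plus `ε`, while both end points are at least that half
away. -/
lemma IsGeodesicSubdomain.one_le_of_diamCigar (hD : IsGeodesicSubdomain Ω) {A : ℝ} (hA : 0 < A)
    (hdc : DiamCigar Ω A) : 1 ≤ A := by
  by_contra hlt
  rw [not_le] at hlt
  obtain ⟨x, hx⟩ := hD.subdomain.2.1.nonempty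
  obtain ⟨p, hp⟩ := hD.frontier_nonempty
  have hd := hD.bdryDist_pos hx
  set ε := min (bdryDist Ω x / 2) ((1 - A) * bdryDist Ω x / 4) with hε
  have hε0 : 0 < ε := lt_min (half_pos hd) (by have := sub_pos.2 hlt; positivity)
  have hε1 : ε ≤ bdryDist Ω x / 2 := min_le_left _ _
  have hε2 : ε ≤ (1 - A) * bdryDist Ω x / 4 := min_le_right _ _
  obtain ⟨y, hy, hpy⟩ := Metric.mem_closure_iff.1 hp.1 ε hε0
  have hdy : bdryDist Ω y ≤ dist p y := by
    rw [dist_comm]; exact Metric.infDist_le_dist_of_mem hp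
  have hxy := bdryDist_le_add Ω x y
  obtain ⟨g, L, hg, rfl, rfl⟩ := hD.exists_isGeod hx hy
  have hcont : ContinuousOn (fun s => dist (g s) (g L)) (Icc 0 L) :=
    (continuous_id.dist continuous_const).comp_continuousOn hg.toIsCurve.continuousOn
  obtain ⟨w, hw, hwd⟩ := intermediate_value_Icc' hg.le hcont
    (show dist (g 0) (g L) / 2 ∈ Icc (dist (g L) (g L)) (dist (g 0) (g L)) by
      rw [dist_self]; constructor <;> linarith [dist_nonneg (x := g 0) (y := g L)])
  have h1 := hdc g 0 L w hg hw.1 hw.2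
  have h2 := bdryDist_le_add Ω (g w) (g L)
  have h3 := dist_triangle (g 0) (g w) (g L)
  simp only at hwd
  have h4 : dist (g 0) (g L) / 2 ≤ min (dist (g 0) (g w)) (dist (g L) (g w)) :=
    le_min (by linarith) (by rw [dist_comm (g L)]; linarith)
  have h5 : A * bdryDist Ω (g w) ≤ A * (ε + dist (g 0) (g L) / 2) := by gcongr; linarith
  nlinarith

/-! ### Doubling -/

/-- The points of `S` are at pairwise distance at least `ρ`. -/
def Separated (ρ : ℝ) (S : Finset X) : Prop := ∀ y ∈ S, ∀ z ∈ S, y ≠ z → ρ ≤ dist y z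

open Classical in
lemma exists_maximal_separated {E : Set X} {ρ : ℝ} {N : ℕ}
    (hN : ∀ S : Finset X, ↑S ⊆ E → Separated ρ S → S.card ≤ N) :
    ∃ P : Finset X, ↑P ⊆ E ∧ Separated ρ P ∧ ∀ y ∈ E, ∃ p ∈ P, dist y p < ρ ∨ y = p := by
  obtain ⟨P, ⟨hPE, hP⟩, hmax⟩ : ∃ P : Finset X, ((↑P : Set X) ⊆ E ∧ Separated ρ P) ∧
      ∀ S : Finset X, (↑S : Set X) ⊆ E ∧ Separated ρ S → S.card ≤ P.card := by
    let T : Set ℕ := {k | ∃ S : Finset X, ((↑S : Set X) ⊆ E ∧ Separated ρ S) ∧ S.card = k}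
    have hne : T.Nonempty := ⟨0, ∅, ⟨by simp, by simp [Separated]⟩, rfl⟩
    have hbdd : BddAbove T := ⟨N, by rintro k ⟨S, hS, rfl⟩; exact hN S hS.1 hS.2⟩
    obtain ⟨P, hP, hcard⟩ := Nat.sSup_mem hne hbdd
    exact ⟨P, hP, fun S hS => by rw [hcard]; exact le_csSup hbdd ⟨S, hS, rfl⟩⟩
  refine ⟨P, hPE, hP, fun y hy => ?_⟩
  by_contra hcon
  push Not at hcon
  have hyP : y ∉ P := fun h => (hcon y h).2 rfl
  have := hmax (insert y P) ⟨by
    rw [Finset.coe_insert]; exact insert_subset hy hPE, by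
    intro u hu v hv huv
    rcases Finset.mem_insert.1 hu with rfl | hu' <;> rcases Finset.mem_insert.1 hv with rfl | hv'
    · exact absurd rfl huv
    · exact (hcon v hv').1
    · rw [dist_comm]; exact (hcon u hu').1
    · exact hP u hu' v hv' huv⟩
  rw [Finset.card_insert_of_notMem hyP] at this
  omega

lemma IsDoubling.one_le {Q : ℝ} (h : IsDoubling X Q) (x : X) : 1 ≤ Q := by
  have := h x 1 one_pos {x} (by simp) (by simp)
  simpa using this

-- Induction on the scale: a maximal `R / 2`-separated subset has at most `Q` points, and the
-- half-size balls about them cover the set.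
open Classical in
lemma IsDoubling.card_le {Q : ℝ} (h : IsDoubling X Q) (n : ℕ) :
    ∀ (x : X) (R : ℝ), 0 < R → ∀ S : Finset X, (∀ y ∈ S, y ∈ Metric.ball x R) →
      Separated (R / 2 ^ (n + 1)) S → (S.card : ℝ) ≤ Q ^ (n + 1) := by
  induction n with
  | zero =>
    intro x R hR S hS hsep
    rw [zero_add, pow_one]
    exact h x R hR S hS (by simpa [Separated] using hsep)
  | succ n ih =>
    intro x R hR S hS hsep
    obtain ⟨P, hPS, hP, hcov⟩ := exists_maximal_separated (E := (↑S : Set X)) (ρ := R / 2)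
      (N := S.card) fun T hT _ => Finset.card_le_card (by exact_mod_cast hT)
    have hPc : (P.card : ℝ) ≤ Q := h x R hR P (fun y hy => hS y (by exact_mod_cast hPS hy)) hP
    have hsub : S ⊆ P.biUnion fun p => S.filter fun y => y ∈ Metric.ball p (R / 2) := by
      intro y hy
      obtain ⟨p, hp, hyp⟩ := hcov y (by exact_mod_cast hy)
      refine Finset.mem_biUnion.2 ⟨p, hp, Finset.mem_filter.2 ⟨hy, ?_⟩⟩
      rcases hyp with hyp | rfl
      · exact hyp
      · exact Metric.mem_ball_self (half_pos hR)
    have hpiece : ∀ p ∈ P, ((S.filter fun y => y ∈ Metric.ball p (R / 2)).card : ℝ) ≤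
        Q ^ (n + 1) := fun p _ => by
      refine ih p (R / 2) (half_pos hR) _ (fun y hy => (Finset.mem_filter.1 hy).2) ?_
      intro u hu v hv huv
      have := hsep u (Finset.mem_filter.1 hu).1 v (Finset.mem_filter.1 hv).1 huv
      rwa [div_div, ← pow_succ']
    have hQ : 1 ≤ Q := h.one_le x
    calc (S.card : ℝ) ≤ ((P.biUnion fun p => S.filter fun y => y ∈ Metric.ball p (R / 2)).card : ℝ) := by
          exact_mod_cast Finset.card_le_card hsub
      _ ≤ ∑ p ∈ P, ((S.filter fun y => y ∈ Metric.ball p (R / 2)).card : ℝ) := by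
          exact_mod_cast Finset.card_biUnion_le
      _ ≤ ∑ _p ∈ P, Q ^ (n + 1) := Finset.sum_le_sum hpiece
      _ = P.card * Q ^ (n + 1) := by rw [Finset.sum_const, nsmul_eq_mul]
      _ ≤ Q * Q ^ (n + 1) := by gcongr
      _ = Q ^ (n + 1 + 1) := (pow_succ' _ _).symm

lemma IsDoubling.exists_cover {Q : ℝ} (h : IsDoubling X Q) (n : ℕ) {x : X} {R : ℝ} (hR : 0 < R)
    {E : Set X} (hE : E ⊆ Metric.ball x R) :
    ∃ P : Finset X, (P.card : ℝ) ≤ Q ^ (n + 1) ∧ ∀ y ∈ E, ∃ p ∈ P, dist y p < R / 2 ^ (n + 1) := by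
  obtain ⟨N, hN⟩ := exists_nat_ge (Q ^ (n + 1))
  obtain ⟨P, hPE, hP, hcov⟩ := exists_maximal_separated (E := E) (ρ := R / 2 ^ (n + 1)) (N := N)
    fun S hS hsep => by
      exact_mod_cast (h.card_le n x R hR S (fun y hy => hE (hS (by exact_mod_cast hy))) hsep).trans hN
  refine ⟨P, h.card_le n x R hR P (fun y hy => hE (hPE (by exact_mod_cast hy))) hP, fun y hy => ?_⟩
  obtain ⟨p, hp, hyp | rfl⟩ := hcov y hy
  · exact ⟨p, hp, hyp⟩
  · exact ⟨y, hp, by rw [dist_self]; positivity⟩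

/-! ### The length cigar condition -/

/-- Every point `w` of a quasihyperbolic geodesic splits it into two arcs one of which has length
at most `M d_Ω(w)`. -/
def LengthCigar (Ω : Set X) (M : ℝ) : Prop :=
  ∀ (g : ℝ → X) (a b w : ℝ), IsGeod Ω g a b → a ≤ w → w ≤ b →
    min (w - a) (b - w) ≤ M * bdryDist Ω (g w)

/-- Cut the arc into dyadic layers of boundary distance. Each layer has measure at most `Q ^ (n +
1)` times twice its scale, and the scales sum geometrically from `(1 + A) * ρ`, the largest boundary
distance that `hclose` allows. -/
lemma IsGeodesicSubdomain.sub_le_of_dist_le (hD : IsGeodesicSubdomain Ω) {A Q : ℝ} (hA : 1 ≤ A)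
    (hdc : DiamCigar Ω A) (hdoub : IsDoubling X Q) {n : ℕ} (hn : 40 * A ^ 2 ≤ 2 ^ (n + 1))
    {g : ℝ → X} {a t : ℝ} (hg : IsGeod Ω g a t)
    (hclose : ∀ s, a ≤ s → s ≤ t → dist (g s) (g t) ≤ A * bdryDist Ω (g t)) :
    t - a ≤ 8 * A * Q ^ (n + 1) * bdryDist Ω (g t) := by
  set ρ := bdryDist Ω (g t) with hρ
  have hρ0 : 0 < ρ := hD.bdryDist_pos (hg.mem t hg.le le_rfl)
  have hQ : 1 ≤ Q := hdoub.one_le (g t)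
  have hd0 : ∀ s, a ≤ s → s ≤ t → 0 < bdryDist Ω (g s) := fun s h1 h2 =>
    hD.bdryDist_pos (hg.mem s h1 h2)
  set η : ℕ → ℝ := fun j => (1 + A) * ρ * (1 / 2) ^ j with hη
  have hη0 : ∀ j, 0 < η j := fun j => by simp only [hη]; positivity
  set E : ℕ → Set ℝ := fun j =>
    {s | a ≤ s ∧ s ≤ t ∧ η j / 2 < bdryDist Ω (g s) ∧ bdryDist Ω (g s) ≤ η j} with hE
  have hcover : Icc a t ⊆ ⋃ j, E j := by
    intro s hs
    have h1 := hd0 s hs.1 hs.2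
    have h2 : bdryDist Ω (g s) ≤ (1 + A) * ρ := by
      have := bdryDist_le_add Ω (g s) (g t)
      have := hclose s hs.1 hs.2
      linarith
    have h3 : 0 < (1 + A) * ρ := by positivity
    obtain ⟨j, hj1, hj2⟩ := exists_nat_pow_near_of_lt_one (div_pos h1 h3)
      ((div_le_one h3).2 h2) (show (0 : ℝ) < 1 / 2 by norm_num) (by norm_num)
    rw [lt_div_iff₀ h3] at hj1
    rw [div_le_iff₀ h3] at hj2
    refine mem_iUnion.2 ⟨j, hs.1, hs.2, ?_, ?_⟩
    · simp only [hη]; rw [pow_succ] at hj1; linarith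
    · simp only [hη]; linarith
  -- Apply the diameter cigar at `s'` to the arc from `s` to `t`. If `g t` is the near end point,
  -- then `ρ` is at most `(1 + A) * η j`, and `hclose` bounds the distance through `g t`.
  have hpair : ∀ j, ∀ s ∈ E j, ∀ s' ∈ E j, s ≤ s' → dist (g s) (g s') ≤ 4 * A ^ 2 * η j := by
    rintro j s ⟨h1, h2, h3, h4⟩ s' ⟨h1', h2', h3', h4'⟩ hss
    have hηj := hη0 j
    rcases min_le_iff.1 (hdc g s t s' (hD.isGeod_sub hg h1 h2 le_rfl) hss h2') with hc | hc
    · have : A * bdryDist Ω (g s') ≤ A * η j := by gcongr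
      have hA2 : A * η j ≤ 4 * A ^ 2 * η j := by gcongr; nlinarith
      linarith
    · have e1 : ρ ≤ (1 + A) * bdryDist Ω (g s') := by
        have := bdryDist_le_add Ω (g t) (g s')
        linarith
      have e2 := dist_triangle (g s) (g t) (g s')
      have e3 := hclose s h1 h2
      have e4 := hclose s' h1' h2'
      rw [dist_comm] at e4
      have e5 : A * ρ ≤ A * ((1 + A) * bdryDist Ω (g s')) := by gcongr
      have e6 : A * ((1 + A) * bdryDist Ω (g s')) ≤ A * ((1 + A) * η j) := by gcongr
      have e7 : A * ((1 + A) * η j) ≤ A * ((A + A) * η j) := by gcongr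
      nlinarith
  have hvol : ∀ j, volume (E j) ≤ ENNReal.ofReal (Q ^ (n + 1) * (2 * η j)) := by
    intro j
    rcases (E j).eq_empty_or_nonempty with he | ⟨s₀, hs₀⟩
    · rw [he, measure_empty]; exact zero_le
    have hηj := hη0 j
    have hball : g '' E j ⊆ Metric.ball (g s₀) (5 * A ^ 2 * η j) := by
      rintro _ ⟨s, hs, rfl⟩
      rw [Metric.mem_ball]
      have : 4 * A ^ 2 * η j < 5 * A ^ 2 * η j := by gcongr; norm_num
      refine lt_of_le_of_lt ?_ this
      rcases le_total s s₀ with h | h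
      · exact hpair j s hs s₀ hs₀ h
      · rw [dist_comm]; exact hpair j s₀ hs₀ s hs h
    obtain ⟨P, hPc, hP⟩ := hdoub.exists_cover n (by positivity) hball
    -- The factor 40 in `hn` serves here: balls of radius `η j / 8` keep two points of the layer at
    -- quasihyperbolic distance below 1, so the arc between them has length at most `2 * η j`.
    have hr : 5 * A ^ 2 * η j / 2 ^ (n + 1) ≤ η j / 8 := by
      rw [div_le_div_iff₀ (by positivity) (by norm_num)]
      nlinarith
    have hsub : E j ⊆ ⋃ p ∈ P, {s ∈ E j | dist (g s) p < η j / 8} := by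
      intro s hs
      obtain ⟨p, hp, hsp⟩ := hP (g s) ⟨s, hs, rfl⟩
      exact mem_iUnion₂.2 ⟨p, hp, hs, hsp.trans_le hr⟩
    have hpiece : ∀ p ∈ P, volume {s ∈ E j | dist (g s) p < η j / 8} ≤
        ENNReal.ofReal (2 * η j) := by
      intro p _
      have key : ∀ s ∈ {s ∈ E j | dist (g s) p < η j / 8},
          ∀ s' ∈ {s ∈ E j | dist (g s) p < η j / 8}, s ≤ s' →
          edist s s' ≤ ENNReal.ofReal (2 * η j) := by
        rintro s ⟨⟨h1, h2, h3, h4⟩, h5⟩ s' ⟨⟨h1', h2', h3', h4'⟩, h5'⟩ hss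
        rw [edist_comm, edist_dist, Real.dist_eq, abs_of_nonneg (sub_nonneg.2 hss)]
        apply ENNReal.ofReal_le_ofReal
        have e1 := dist_triangle_right (g s) (g s') p
        have e2 := hD.qhd_lt_one (hg.mem s h1 h2) (show dist (g s) (g s') < _ by linarith)
        have e3 := hD.sub_le_mul_exp (hD.isGeod_sub hg h1 hss h2')
        have e4 : Real.exp (qhd Ω (g s) (g s')) ≤ 3 :=
          (Real.exp_le_exp.2 e2.le).trans (by linarith [Real.exp_one_lt_d9])
        have e5 := hd0 s h1 h2
        nlinarith
      refine (Real.volume_le_diam _).trans (Metric.ediam_le fun s hs s' hs' => ?_)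
      rcases le_total s s' with h | h
      · exact key s hs s' hs' h
      · rw [edist_comm]; exact key s' hs' s hs h
    calc volume (E j) ≤ ∑ p ∈ P, volume {s ∈ E j | dist (g s) p < η j / 8} :=
          (measure_mono hsub).trans (measure_biUnion_finset_le P _)
      _ ≤ ∑ _p ∈ P, ENNReal.ofReal (2 * η j) := Finset.sum_le_sum hpiece
      _ = ENNReal.ofReal (P.card * (2 * η j)) := by
          rw [Finset.sum_const, nsmul_eq_mul, ENNReal.ofReal_mul (p := (P.card : ℝ)) (by positivity),
            ENNReal.ofReal_natCast]
      _ ≤ _ := ENNReal.ofReal_le_ofReal (by gcongr)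
  have htot : ENNReal.ofReal (t - a) ≤ ENNReal.ofReal (4 * Q ^ (n + 1) * ((1 + A) * ρ)) := by
    rw [← Real.volume_Icc]
    calc volume (Icc a t) ≤ ∑' j, volume (E j) := (measure_mono hcover).trans (measure_iUnion_le _)
      _ ≤ ∑' j, ENNReal.ofReal (Q ^ (n + 1) * (2 * η j)) := ENNReal.tsum_le_tsum hvol
      _ = ∑' j : ℕ, ENNReal.ofReal (Q ^ (n + 1) * (2 * ((1 + A) * ρ)) * (1 / 2) ^ j) := by
          congr 1; ext j; congr 1; simp only [hη]; ring
      _ = ENNReal.ofReal (4 * Q ^ (n + 1) * ((1 + A) * ρ)) := by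
          rw [← ENNReal.ofReal_tsum_of_nonneg (fun j => by positivity)
            (summable_geometric_two.mul_left _), tsum_mul_left, tsum_geometric_two]
          congr 1; ring
  have hfin := (ENNReal.ofReal_le_ofReal_iff (by positivity)).1 htot
  refine hfin.trans ?_
  have : (1 + A) * ρ ≤ (A + A) * ρ := by gcongr
  have h4 : 0 ≤ 4 * Q ^ (n + 1) := by positivity
  nlinarith [mul_le_mul_of_nonneg_left this h4]

lemma IsGeodesicSubdomain.lengthCigar (hD : IsGeodesicSubdomain Ω) {A Q : ℝ} (hA : 1 ≤ A)
    (hdc : DiamCigar Ω A) (hdoub : IsDoubling X Q) {n : ℕ} (hn : 40 * A ^ 2 ≤ 2 ^ (n + 1)) :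
    LengthCigar Ω (8 * A * Q ^ (n + 1)) := by
  intro g a b w hg haw hwb
  by_cases h : ∀ s, a ≤ s → s ≤ w → dist (g s) (g w) ≤ A * bdryDist Ω (g w)
  · exact (min_le_left _ _).trans
      (hD.sub_le_of_dist_le hA hdc hdoub hn (hD.isGeod_sub hg le_rfl haw hwb) h)
  -- If some earlier point is too far from `g w`, the diameter cigar on every arc from it through
  -- `w` puts the other end point near `g w`. The second half then satisfies the closeness
  -- hypothesis.
  · push Not at h
    obtain ⟨s, has, hsw, hs⟩ := h
    have hr := hD.isGeod_reverse (hD.isGeod_sub hg haw hwb le_rfl) 0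
    have := hD.sub_le_of_dist_le hA hdc hdoub hn hr fun u hu1 hu2 => by
      have h1 := hdc g s (0 - u) w (hD.isGeod_sub hg has (by linarith) (by linarith)) hsw
        (by linarith)
      simp only [sub_sub_cancel]
      exact (min_le_iff.1 h1).resolve_left (not_le.2 hs)
    simp only [sub_sub_cancel] at this
    exact (min_le_right _ _).trans (by linarith)

/-! ### Tracks -/

/-- A track `T` over `p`: for each scale `τ` in `[s₀, s₁]`, the point `T τ` has distance at most
`2 τ` from `p` and at least `τ / M` from the boundary, and `T` moves slowly in the
quasihyperbolic distance. -/
structure IsTrack (Ω : Set X) (M : ℝ) (p : X) (s₀ s₁ : ℝ) (T : ℝ → X) : Prop where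
  mem : ∀ τ, s₀ ≤ τ → τ ≤ s₁ → T τ ∈ Ω
  dist_le : ∀ τ, s₀ ≤ τ → τ ≤ s₁ → dist (T τ) p ≤ 2 * τ
  le_mul : ∀ τ, s₀ ≤ τ → τ ≤ s₁ → τ ≤ M * bdryDist Ω (T τ)
  qhd_le : ∀ τ τ', s₀ ≤ τ → τ ≤ τ' → τ' ≤ s₁ → qhd Ω (T τ) (T τ') ≤ M * Real.log (τ' / τ)

lemma IsTrack.mono {M : ℝ} {p : X} {s₀ s₁ t₀ t₁ : ℝ} {T : ℝ → X} (h : IsTrack Ω M p s₀ s₁ T)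
    (h0 : s₀ ≤ t₀) (h1 : t₁ ≤ s₁) : IsTrack Ω M p t₀ t₁ T where
  mem τ a b := h.mem τ (h0.trans a) (b.trans h1)
  dist_le τ a b := h.dist_le τ (h0.trans a) (b.trans h1)
  le_mul τ a b := h.le_mul τ (h0.trans a) (b.trans h1)
  qhd_le τ τ' a b c := h.qhd_le τ τ' (h0.trans a) b (c.trans h1)

lemma LengthCigar.le_mul {M L τ : ℝ} (hM : LengthCigar Ω M) {g : ℝ → X} (hg : IsGeod Ω g 0 L)
    (hτ : 0 ≤ τ) (hL : 2 * τ ≤ L) : τ ≤ M * bdryDist Ω (g τ) := by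
  have := hM g 0 L τ hg hτ (by linarith)
  rw [sub_zero, min_eq_left (by linarith)] at this
  exact this

/-- Only the first half of the geodesic is used, where the shorter arc is the initial one. The
factor 2 in the distance to `p` absorbs the starting offset, at most `s₀ ≤ τ`. -/
lemma LengthCigar.isTrack {M L s₀ s₁ : ℝ} (hc : LengthCigar Ω M) (hM : 0 < M) {g : ℝ → X} {p : X}
    (hg : IsGeod Ω g 0 L) (hs₀ : 0 < s₀) (hL : 2 * s₁ ≤ L) (hp : dist (g 0) p ≤ s₀) :
    IsTrack Ω M p s₀ s₁ g where
  mem τ a b := hg.mem τ (by linarith) (by linarith)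
  dist_le τ a b := by
    have e1 := hg.dist_le 0 τ le_rfl (by linarith) (by linarith)
    have e2 := dist_triangle_left (g τ) p (g 0)
    linarith
  le_mul τ a b := hc.le_mul hg (by linarith) (by linarith)
  qhd_le τ τ' a b c := (hg.toIsCurve.sub (by linarith) b (by linarith)).qhd_le_log (by linarith) hM
    fun r h1 h2 => hc.le_mul hg (by linarith) (by linarith)

namespace IsGeodesicSubdomain
variable (hD : IsGeodesicSubdomain Ω)
include hD

lemma isGeod_reverse_zero {g : ℝ → X} {L : ℝ} (hg : IsGeod Ω g 0 L) :
    IsGeod Ω (fun s => g (L - s)) 0 L := by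
  have := hD.isGeod_reverse hg L
  rwa [sub_self, sub_zero] at this

/-- The logarithmic bound fails at arc length 0. Up to `s / (2 * M)` the boundary distance stays at
least `s / (2 * M)`, which costs at most 1; the logarithmic bound takes over from there. -/
lemma qhd_start_le {M L s τ τ' : ℝ} (hM : 0 < M) (hc : LengthCigar Ω M) {g : ℝ → X}
    (hg : IsGeod Ω g 0 L) (hs : 0 < s) (hsd : s ≤ M * bdryDist Ω (g 0)) (hτ : 0 ≤ τ)
    (hL : 2 * τ ≤ L) (hττ' : τ ≤ τ') (hτ' : s / (2 * M) ≤ τ') :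
    qhd Ω (g 0) (g τ) ≤ 1 + M * Real.log (2 * M * τ' / s) := by
  have hσ0 : 0 < s / (2 * M) := by positivity
  have hd0 : s / (2 * M) * 2 ≤ bdryDist Ω (g 0) := by
    rw [div_mul_eq_mul_div, div_le_iff₀ (by positivity)]; linarith
  have hshort : ∀ r, 0 ≤ r → r ≤ s / (2 * M) → r ≤ τ → qhd Ω (g 0) (g r) ≤ 1 := by
    intro r h0 h1 h2
    refine ((hg.toIsCurve.sub le_rfl h0 (by linarith)).qhd_le_of_le hσ0 fun q h3 h4 => ?_).trans ?_
    · have e1 := hg.dist_le 0 q le_rfl h3 (by linarith)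
      have e2 := bdryDist_le_add Ω (g 0) (g q)
      linarith
    · rw [div_le_one hσ0]; linarith
  have hlog : 0 ≤ Real.log (2 * M * τ' / s) := by
    apply Real.log_nonneg
    rw [div_le_iff₀ (by positivity)] at hτ'
    rw [one_le_div hs]; linarith
  rcases le_total τ (s / (2 * M)) with h | h
  · have := hshort τ hτ h le_rfl
    have := mul_nonneg hM.le hlog
    linarith
  · have e1 := hshort _ hσ0.le le_rfl h
    have e2 := (hg.toIsCurve.sub hσ0.le h (by linarith)).qhd_le_log hσ0 hM
      fun r h1 h2 => hc.le_mul hg (by linarith) (by linarith)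
    have e3 := hD.qhd_triangle (hg.mem 0 le_rfl hg.le)
      (hg.mem (s / (2 * M)) hσ0.le (by linarith)) (hg.mem τ hτ (by linarith))
    have e4 : Real.log (τ / (s / (2 * M))) ≤ Real.log (2 * M * τ' / s) := by
      apply Real.log_le_log (div_pos (hσ0.trans_le h) hσ0)
      rw [div_div_eq_mul_div]
      gcongr ?_ / s
      nlinarith
    have := mul_le_mul_of_nonneg_left e4 hM.le
    linarith

/-- Boundedly many points of a given scale are pairwise far apart in the quasihyperbolic
distance. -/
lemma card_le_of_one_le_qhd {Q M τ : ℝ} (hdoub : IsDoubling X Q) (hM : 0 < M) {n : ℕ}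
    (hn : 6 * M ≤ 2 ^ (n + 1)) (hτ : 0 < τ) {p : X} {k : ℕ} {v : Fin k → X}
    (hv : ∀ i, v i ∈ Ω) (hp : ∀ i, dist (v i) p ≤ 2 * τ) (hd : ∀ i, τ ≤ M * bdryDist Ω (v i))
    (hsep : ∀ i j, i ≠ j → 1 ≤ qhd Ω (v i) (v j)) : (k : ℝ) ≤ Q ^ (n + 1) := by
  have hinj : Function.Injective v := by
    intro i j hij
    by_contra hne
    have := hsep i j hne
    rw [hij, hD.qhd_self (hv j)] at this
    linarith
  have := hdoub.card_le n p (3 * τ) (by positivity) (Finset.univ.map ⟨v, hinj⟩) ?_ ?_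
  · simpa using this
  · intro y hy
    obtain ⟨i, -, rfl⟩ := Finset.mem_map.1 hy
    exact Metric.mem_ball.2 (lt_of_le_of_lt (hp i) (by linarith))
  · intro y hy z hz hyz
    obtain ⟨i, -, rfl⟩ := Finset.mem_map.1 hy
    obtain ⟨j, -, rfl⟩ := Finset.mem_map.1 hz
    have hij : i ≠ j := fun h => hyz (by rw [h])
    by_contra hlt
    -- Points closer than this would be at quasihyperbolic distance below 1.
    have h1 : 3 * τ / 2 ^ (n + 1) ≤ bdryDist Ω (v i) / 2 := by
      rw [div_le_div_iff₀ (by positivity) (by norm_num)]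
      have := hd i
      have hpos := bdryDist_nonneg Ω (v i)
      nlinarith
    exact absurd (hsep i j hij) (not_le.2 (hD.qhd_lt_one (hv i) ((not_le.1 hlt).trans_le h1)))

end IsGeodesicSubdomain

/-! ### Branching configurations of tracks -/

/-- Tracks `A`, `B` that start close to each other and end at distance at least `D`, together with
`m` tracks that stay `D`-far from `A`, from `B` and from each other. -/
structure IsBranching (Ω : Set X) (M : ℝ) (p : X) (m : ℕ) (D s₀ s₁ : ℝ) (A B : ℝ → X)
    (O : Fin m → ℝ → X) : Prop where
  pos : 0 < s₀
  le : s₀ ≤ s₁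
  trackA : IsTrack Ω M p s₀ s₁ A
  trackB : IsTrack Ω M p s₀ s₁ B
  trackO : ∀ i, IsTrack Ω M p s₀ s₁ (O i)
  bot : qhd Ω (A s₀) (B s₀) ≤ D / 4
  top : D ≤ qhd Ω (A s₁) (B s₁)
  sepA : ∀ i τ, s₀ ≤ τ → τ ≤ s₁ → D ≤ qhd Ω (O i τ) (A τ)
  sepB : ∀ i τ, s₀ ≤ τ → τ ≤ s₁ → D ≤ qhd Ω (O i τ) (B τ)
  sepO : ∀ i j, i ≠ j → ∀ τ, s₀ ≤ τ → τ ≤ s₁ → D ≤ qhd Ω (O i τ) (O j τ)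

namespace IsGeodesicSubdomain
variable (hD : IsGeodesicSubdomain Ω)
include hD

lemma isBranching_swap {M : ℝ} {p : X} {m : ℕ} {D s₀ s₁ : ℝ} {A B : ℝ → X} {O : Fin m → ℝ → X}
    (h : IsBranching Ω M p m D s₀ s₁ A B O) : IsBranching Ω M p m D s₀ s₁ B A O where
  pos := h.pos
  le := h.le
  trackA := h.trackB
  trackB := h.trackA
  trackO := h.trackO
  bot := by
    rw [hD.qhd_comm (h.trackB.mem _ le_rfl h.le) (h.trackA.mem _ le_rfl h.le)]; exact h.bot
  top := by
    rw [hD.qhd_comm (h.trackB.mem _ h.le le_rfl) (h.trackA.mem _ h.le le_rfl)]; exact h.top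
  sepA := h.sepB
  sepB := h.sepA
  sepO := h.sepO

/-- The new pair is `A` and the geodesic `β` leaving it at scale `s`; `B` joins the others. The
window starts at `2 * s` because `β 0` is only known to lie within `2 * s` of `p`. -/
lemma isBranching_of_geodesic {M : ℝ} (hM : 1 ≤ M) (hc : LengthCigar Ω M) {p : X} {m : ℕ}
    {D s₀ s₁ s κ L : ℝ} {A B β : ℝ → X} {O : Fin m → ℝ → X}
    (h : IsBranching Ω M p m D s₀ s₁ A B O) (hDM : 2048 * M ^ 3 ≤ D) (hs₀ : s₀ ≤ s)
    (hκ : κ = Real.exp (D / (16 * M))) (hκ2 : 2 ≤ κ) (hs₁ : κ * s ≤ s₁)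
    (hβ : IsGeod Ω β 0 L) (hβA : β 0 = A s) (hL : 2 * (κ * s) ≤ L)
    (hAB : ∀ τ, s ≤ τ → τ ≤ s₁ → D / 2 ≤ qhd Ω (A τ) (B τ))
    (htop : D / (32 * M) ≤ qhd Ω (A (κ * s)) (β (κ * s))) :
    IsBranching Ω M p (m + 1) (D / (32 * M)) (2 * s) (κ * s) A β (Fin.cons B O) := by
  have hs : 0 < s := h.pos.trans_le hs₀
  have hM0 : 0 < M := by linarith
  have h2s : 2 * s ≤ κ * s := by gcongr
  have hlogκ : Real.log κ = D / (16 * M) := by rw [hκ, Real.log_exp]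
  have hκ0 : 0 < κ := by linarith
  have hM2 : 1 ≤ M ^ 2 := one_le_pow₀ hM
  have hM3 : M ^ 2 ≤ M ^ 3 := pow_le_pow_right₀ hM (by norm_num)
  have hMM : M ≤ M ^ 2 := by nlinarith
  have hD0 : 0 < D := by nlinarith
  have hD' : D / (32 * M) ≤ D / 32 := by
    gcongr; linarith
  have hMlogκ : M * Real.log κ = D / 16 := by rw [hlogκ]; field_simp
  have trA := h.trackA.mono (t₀ := 2 * s) (t₁ := κ * s) (by linarith) hs₁
  have trB := h.trackB.mono (t₀ := 2 * s) (t₁ := κ * s) (by linarith) hs₁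
  have hss₁ : s ≤ s₁ := by linarith
  have hsd : s ≤ M * bdryDist Ω (β 0) := by rw [hβA]; exact h.trackA.le_mul s hs₀ hss₁
  have trβ : IsTrack Ω M p (2 * s) (κ * s) β :=
    hc.isTrack hM0 hβ (by linarith) hL (by rw [hβA]; exact h.trackA.dist_le s hs₀ hss₁)
  have hAs := h.trackA.mem s hs₀ hss₁
  have hstart : ∀ τ, 2 * s ≤ τ → τ ≤ κ * s → qhd Ω (A s) (β τ) ≤ 1 + 2 * M ^ 2 + D / 16 := by
    intro τ h1 h2
    have e1 := hD.qhd_start_le hM0 hc hβ hs hsd (by linarith) (by linarith) h2 (by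
      rw [div_le_iff₀ (by positivity)]
      nlinarith [mul_pos hκ0 hs])
    rw [hβA, show 2 * M * (κ * s) / s = (2 * M) * κ by field_simp,
      Real.log_mul (by positivity) (by positivity), mul_add, hMlogκ] at e1
    have e2 : Real.log (2 * M) ≤ 2 * M := (Real.log_le_self (by positivity))
    nlinarith
  -- Up to scale `κ * s`, both `T` and `β` move by about `D / 16` from their positions at scale `s`,
  -- which are `D / 2` apart.
  have hfar : ∀ T : ℝ → X, IsTrack Ω M p s₀ s₁ T → D / 2 ≤ qhd Ω (T s) (A s) →
      ∀ τ, 2 * s ≤ τ → τ ≤ κ * s → D / (32 * M) ≤ qhd Ω (T τ) (β τ) := by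
    intro T hT hTA τ h1 h2
    have hTs := hT.mem s hs₀ hss₁
    have hTτ := hT.mem τ (by linarith) (by linarith)
    have hβτ := trβ.mem τ h1 h2
    have e1 := hT.qhd_le s τ hs₀ (by linarith) (by linarith)
    have e2 : Real.log (τ / s) ≤ Real.log κ := by
      apply Real.log_le_log (by apply div_pos <;> linarith)
      rwa [div_le_iff₀ hs]
    have e2' := mul_le_mul_of_nonneg_left e2 hM0.le
    have e3 := hstart τ h1 h2
    have e4 := hD.qhd_triangle hTs hTτ hAs
    have e5 := hD.qhd_triangle hTτ hβτ hAs
    rw [hD.qhd_comm hβτ hAs] at e5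
    nlinarith
  refine ⟨by linarith, h2s, trA, trβ, ?_, ?_, htop, ?_, ?_, ?_⟩
  · refine Fin.cases ?_ fun i => ?_
    · simpa using trB
    · simpa using (h.trackO i).mono (by linarith) hs₁
  · have hA2 := trA.mem _ le_rfl h2s
    have hβ2 := trβ.mem _ le_rfl h2s
    have e1 := hD.qhd_triangle hA2 hAs hβ2
    have e2 := h.trackA.qhd_le s (2 * s) hs₀ (by linarith) (by linarith)
    rw [mul_div_cancel_right₀ _ hs.ne', hD.qhd_comm hAs hA2] at e2
    have e3 := hD.qhd_start_le (τ := 2 * s) hM0 hc hβ hs hsd (by linarith) (by linarith) le_rfl (by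
      rw [div_le_iff₀ (by positivity)]; nlinarith)
    rw [hβA, show 2 * M * (2 * s) / s = 4 * M by field_simp; ring] at e3
    have e4 : Real.log (4 * M) ≤ 4 * M := Real.log_le_self (by positivity)
    have e5 : Real.log 2 ≤ 1 := by linarith [Real.log_two_lt_d9]
    -- This requirement fixes the threshold `2048 * M ^ 3`.
    have e6 : 16 * M ^ 2 ≤ D / (32 * M) / 4 := by
      rw [div_div, le_div_iff₀ (by positivity)]
      nlinarith
    nlinarith
  · refine Fin.cases (fun τ h1 h2 => ?_) fun i τ h1 h2 => ?_
    · simp only [Fin.cons_zero]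
      rw [hD.qhd_comm (trB.mem τ h1 h2) (trA.mem τ h1 h2)]
      linarith [hAB τ (by linarith) (by linarith)]
    · simp only [Fin.cons_succ]
      linarith [h.sepA i τ (by linarith) (by linarith)]
  · refine Fin.cases (fun τ h1 h2 => ?_) fun i τ h1 h2 => ?_
    · simp only [Fin.cons_zero]
      refine hfar B h.trackB ?_ τ h1 h2
      rw [hD.qhd_comm (h.trackB.mem s hs₀ hss₁) hAs]
      exact hAB s le_rfl hss₁
    · simp only [Fin.cons_succ]
      exact hfar (O i) (h.trackO i) (by linarith [h.sepA i s hs₀ hss₁]) τ h1 h2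
  · refine Fin.cases (Fin.cases (fun hne => absurd rfl hne) fun j _ τ h1 h2 => ?_) fun i =>
      Fin.cases (fun _ τ h1 h2 => ?_) fun j hij τ h1 h2 => ?_
    · simp only [Fin.cons_zero, Fin.cons_succ]
      rw [hD.qhd_comm (trB.mem τ h1 h2) ((h.trackO j).mem τ (by linarith) (by linarith))]
      linarith [h.sepB j τ (by linarith) (by linarith)]
    · simp only [Fin.cons_zero, Fin.cons_succ]
      linarith [h.sepB i τ (by linarith) (by linarith)]
    · simp only [Fin.cons_succ]
      linarith [h.sepO i j (fun hh => hij (by rw [hh])) τ (by linarith) (by linarith)]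

/-- Each track is `M`-Lipschitz in `log τ`, so the distance between two tracks is `2 * M`-Lipschitz
in it. -/
lemma continuousOn_qhd_track {M : ℝ} {p : X} {s₀ s₁ : ℝ} {A B : ℝ → X} (h0 : 0 < s₀)
    (hA : IsTrack Ω M p s₀ s₁ A) (hB : IsTrack Ω M p s₀ s₁ B) :
    ContinuousOn (fun τ => qhd Ω (A τ) (B τ)) (Icc s₀ s₁) := by
  have key : ∀ τ ∈ Icc s₀ s₁, ∀ τ' ∈ Icc s₀ s₁, τ ≤ τ' →
      |qhd Ω (A τ) (B τ) - qhd Ω (A τ') (B τ')| ≤ 2 * M * (Real.log τ' - Real.log τ) := by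
    intro τ hτ τ' hτ' hle
    have a1 := hA.mem τ hτ.1 hτ.2
    have a2 := hA.mem τ' hτ'.1 hτ'.2
    have b1 := hB.mem τ hτ.1 hτ.2
    have b2 := hB.mem τ' hτ'.1 hτ'.2
    have e1 := hA.qhd_le τ τ' hτ.1 hle hτ'.2
    have e2 := hB.qhd_le τ τ' hτ.1 hle hτ'.2
    rw [Real.log_div (by linarith [hτ'.1]) (by linarith [hτ.1])] at e1 e2
    have t1 := hD.qhd_triangle a1 a2 b1
    have t2 := hD.qhd_triangle a2 b2 b1
    have t3 := hD.qhd_triangle a2 a1 b2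
    have t4 := hD.qhd_triangle a1 b1 b2
    rw [hD.qhd_comm b2 b1] at t2
    rw [hD.qhd_comm a2 a1] at t3
    rw [abs_le]
    constructor <;> linarith
  intro τ hτ
  have hlog : Tendsto (fun τ' => 2 * M * |Real.log τ' - Real.log τ|) (𝓝[Icc s₀ s₁] τ) (𝓝 0) := by
    have hc : ContinuousAt (fun τ' => 2 * M * |Real.log τ' - Real.log τ|) τ :=
      continuousAt_const.mul
        ((Real.continuousAt_log (by linarith [hτ.1])).sub continuousAt_const).abs
    have := hc.tendsto
    simp only [sub_self, abs_zero, mul_zero] at this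
    exact tendsto_nhdsWithin_of_tendsto_nhds this
  rw [ContinuousWithinAt, tendsto_iff_dist_tendsto_zero]
  refine squeeze_zero' (Eventually.of_forall fun _ => dist_nonneg) ?_ hlog
  filter_upwards [self_mem_nhdsWithin] with τ' hτ'
  rw [Real.dist_eq]
  rcases le_total τ τ' with h | h
  · rw [abs_sub_comm]
    refine (key τ hτ τ' hτ' h).trans_eq ?_
    rw [abs_of_nonneg (sub_nonneg.2 (Real.log_le_log (by linarith [hτ.1]) h))]
  · refine (key τ' hτ' τ hτ h).trans_eq ?_
    rw [abs_sub_comm (Real.log τ'), abs_of_nonneg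
      (sub_nonneg.2 (Real.log_le_log (by linarith [hτ'.1]) h))]

/-- A branching with a large gap produces another one with one more track. -/
lemma exists_isBranching_succ {M : ℝ} (hM : 1 ≤ M) (hc : LengthCigar Ω M) {p : X} {m : ℕ}
    {D s₀ s₁ : ℝ} {A B : ℝ → X} {O : Fin m → ℝ → X}
    (h : IsBranching Ω M p m D s₀ s₁ A B O) (hDM : 2048 * M ^ 3 ≤ D) :
    ∃ t₀ t₁ A' B' O', IsBranching Ω M p (m + 1) (D / (32 * M)) t₀ t₁ A' B' O' := by
  have hM0 : 0 < M := by linarith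
  have hM2 : 1 ≤ M ^ 2 := one_le_pow₀ hM
  have hM3 : M ^ 2 ≤ M ^ 3 := pow_le_pow_right₀ hM (by norm_num)
  have hMM : M ≤ M ^ 2 := by nlinarith
  have hD0 : 0 < D := by nlinarith
  have hcont := hD.continuousOn_qhd_track h.pos h.trackA h.trackB
  have hcomp : IsCompact (Icc s₀ s₁ ∩ (fun τ => qhd Ω (A τ) (B τ)) ⁻¹' Iic (D / 2)) :=
    isCompact_Icc.of_isClosed_subset (hcont.preimage_isClosed_of_isClosed isClosed_Icc isClosed_Iic)
      inter_subset_left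
  -- `s` is the last scale at which the tracks are within `D / 2`; by continuity their distance
  -- there equals `D / 2`.
  obtain ⟨s, ⟨hs, hsf⟩, hmax⟩ := hcomp.exists_isGreatest
    ⟨s₀, ⟨le_rfl, h.le⟩, by simp only [mem_preimage, mem_Iic]; linarith [h.bot]⟩
  simp only [mem_preimage, mem_Iic] at hsf
  have hs0 : 0 < s := h.pos.trans_le hs.1
  have hgt : ∀ τ, s < τ → τ ≤ s₁ → D / 2 < qhd Ω (A τ) (B τ) := by
    intro τ h1 h2
    by_contra hn
    exact absurd (hmax ⟨⟨hs.1.trans h1.le, h2⟩, not_lt.1 hn⟩) (not_le.2 h1)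
  have hseq : qhd Ω (A s) (B s) = D / 2 := by
    obtain ⟨τ, hτ, he⟩ := intermediate_value_Icc hs.2 (hcont.mono (Icc_subset_Icc_left hs.1))
      (show D / 2 ∈ Icc _ _ from ⟨hsf, by linarith [h.top]⟩)
    simp only at he
    rcases hτ.1.eq_or_lt with rfl | hlt
    · exact he
    · exact absurd he (hgt τ hlt hτ.2).ne'
  have hAB : ∀ τ, s ≤ τ → τ ≤ s₁ → D / 2 ≤ qhd Ω (A τ) (B τ) := by
    intro τ h1 h2
    rcases h1.eq_or_lt with rfl | hlt
    · exact hseq.ge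
    · exact (hgt τ hlt h2).le
  have hAs := h.trackA.mem s hs.1 hs.2
  have hBs := h.trackB.mem s hs.1 hs.2
  have hA1 := h.trackA.mem s₁ h.le le_rfl
  have hB1 := h.trackB.mem s₁ h.le le_rfl
  set κ := Real.exp (D / (16 * M)) with hκ
  have hκ0 : 0 < κ := Real.exp_pos _
  have hlogκ : Real.log κ = D / (16 * M) := Real.log_exp _
  have hMlogκ : M * Real.log κ = D / 16 := by rw [hlogκ]; field_simp
  have hbig : 16 * M ≤ D / (16 * M) := by
    rw [le_div_iff₀ (by positivity)]; nlinarith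
  have hκ2 : 2 ≤ κ := by
    have := Real.add_one_le_exp (D / (16 * M))
    linarith
  -- The distance still has to grow by `D / 2`, at rate at most `2 * M` in the logarithm of the
  -- scale.
  have hs₁ : κ * s ≤ s₁ := by
    have e1 := h.trackA.qhd_le s s₁ hs.1 hs.2 le_rfl
    have e2 := h.trackB.qhd_le s s₁ hs.1 hs.2 le_rfl
    have t1 := hD.qhd_triangle hA1 hAs hB1
    have t2 := hD.qhd_triangle hAs hBs hB1
    rw [hD.qhd_comm hA1 hAs] at t1
    have e3 : D / 4 ≤ M * Real.log (s₁ / s) := by linarith [h.top]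
    have e4 : D / (16 * M) ≤ Real.log (s₁ / s) := by
      rw [div_le_iff₀ (by positivity)]; nlinarith
    rw [Real.le_log_iff_exp_le (div_pos (by linarith [hs.2]) hs0), le_div_iff₀ hs0] at e4
    exact e4
  have hsκ : s ≤ κ * s := by nlinarith
  obtain ⟨β, L, hβ, hβ0, hβL⟩ := hD.exists_isGeod hAs hBs
  have hβ' := hD.isGeod_reverse_zero hβ
  have hβ'0 : (fun r => β (L - r)) 0 = B s := by simp only [sub_zero, hβL]
  have hdA : s ≤ M * bdryDist Ω (β 0) := by rw [hβ0]; exact h.trackA.le_mul s hs.1 hs.2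
  have hdB : s ≤ M * bdryDist Ω ((fun r => β (L - r)) 0) := by
    rw [hβ'0]; exact h.trackB.le_mul s hs.1 hs.2
  have hlog2M : Real.log (2 * M) ≤ 2 * M := Real.log_le_self (by positivity)
  -- If `β` were shorter, its midpoint would be reached from either end at cost about `D / 16`,
  -- contradicting the distance `D / 2` of the ends.
  have hL : 2 * (κ * s) ≤ L := by
    by_contra hlt
    rw [not_le] at hlt
    have hcond : s / (2 * M) ≤ κ * s := by
      rw [div_le_iff₀ (by positivity)]; nlinarith
    have e1 := hD.qhd_start_le (τ := L / 2) (τ' := κ * s) hM0 hc hβ hs0 hdA (by linarith [hβ.le])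
      (by linarith) (by linarith) hcond
    have e2 := hD.qhd_start_le (τ := L / 2) (τ' := κ * s) hM0 hc hβ' hs0 hdB (by linarith [hβ.le])
      (by linarith) (by linarith) hcond
    rw [show 2 * M * (κ * s) / s = (2 * M) * κ by field_simp,
      Real.log_mul (by positivity) (by positivity), mul_add, hMlogκ] at e1 e2
    simp only [sub_zero, hβL, hβ0] at e1 e2
    rw [show L - L / 2 = L / 2 by ring] at e2
    have hmid := hβ.mem (L / 2) (by linarith [hβ.le]) (by linarith [hβ.le])
    have e3 := hD.qhd_triangle hAs hmid hBs
    rw [hD.qhd_comm hmid hBs, hseq] at e3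
    nlinarith
  have hdist : dist (A s) (B s) ≤ 4 * s := by
    have := dist_triangle_right (A s) (B s) p
    have := h.trackA.dist_le s hs.1 hs.2
    have := h.trackB.dist_le s hs.1 hs.2
    linarith
  have hupA : bdryDist Ω (A s) ≤ 8 * s := by
    by_contra hn
    have := hD.qhd_lt_one hAs (show dist (A s) (B s) < _ by linarith)
    nlinarith
  have hupB : bdryDist Ω (B s) ≤ 8 * s := by
    by_contra hn
    have := hD.qhd_lt_one hBs (show dist (B s) (A s) < _ by rw [dist_comm]; linarith)
    rw [hD.qhd_comm hBs hAs] at this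
    nlinarith
  -- Along `g` the boundary distance grows from at most `8 * s` to at least `κ * s / M`, and such
  -- growth costs its logarithm.
  have hlow : ∀ g : ℝ → X, IsGeod Ω g 0 L → bdryDist Ω (g 0) ≤ 8 * s →
      D / (32 * M) ≤ qhd Ω (g 0) (g (κ * s)) := by
    intro g hg hg0
    have h0 := hg.mem 0 le_rfl hg.le
    have h1 := hg.mem (κ * s) (by positivity) (by nlinarith)
    have e1 := hc.le_mul hg (τ := κ * s) (by positivity) hL
    have e2 := hD.bdryDist_le_mul_exp h0 h1
    have e3 : κ * s ≤ M * (8 * s * Real.exp (qhd Ω (g 0) (g (κ * s)))) :=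
      e1.trans (mul_le_mul_of_nonneg_left (e2.trans (by gcongr)) hM0.le)
    have e4 : κ ≤ 8 * M * Real.exp (qhd Ω (g 0) (g (κ * s))) := by
      by_contra hn
      nlinarith
    have e5 := Real.log_le_log hκ0 e4
    rw [Real.log_mul (by positivity) (by positivity), hlogκ, Real.log_exp] at e5
    have e6 : Real.log (8 * M) ≤ 8 * M := Real.log_le_self (by positivity)
    have e7 : D / (32 * M) = D / (16 * M) / 2 := by rw [div_div]; congr 1; ring
    rw [e7]
    linarith
  have hlowA := hlow β hβ (by rw [hβ0]; exact hupA)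
  have hlowB := hlow _ hβ' (by simp only [sub_zero, hβL]; exact hupB)
  have hκL : κ * s ≤ L - κ * s := by linarith
  have hκs0 : 0 ≤ κ * s := by positivity
  have hsplit : qhd Ω (A s) (β (κ * s)) + qhd Ω (β (κ * s)) (β (L - κ * s)) +
      qhd Ω (B s) (β (L - κ * s)) = D / 2 := by
    have m1 := hβ.mem (κ * s) hκs0 (by linarith)
    have m2 := hβ.mem (L - κ * s) (by linarith) (by linarith)
    have e1 := hD.qhd_add hβ hκs0 (show κ * s ≤ L by linarith)
    have e2 := hD.qhd_add (hD.isGeod_sub hβ hκs0 (show κ * s ≤ L by linarith) le_rfl) hκL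
      (by linarith)
    rw [hβ0, hβL, hseq] at e1
    rw [hβL, hD.qhd_comm m2 hBs] at e2
    linarith
  -- Both routes share the middle part of `β`. The one from `A s` to `B s` has total exactly `D /
  -- 2`, the one from `A (κ * s)` to `B (κ * s)` at least `D / 2`. So one of the two drifts is at
  -- least `D / (32 * M)`.
  have hsum : qhd Ω (A s) (β (κ * s)) + qhd Ω (B s) (β (L - κ * s)) ≤
      qhd Ω (A (κ * s)) (β (κ * s)) + qhd Ω (B (κ * s)) (β (L - κ * s)) := by
    have m1 := hβ.mem (κ * s) hκs0 (by linarith)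
    have m2 := hβ.mem (L - κ * s) (by linarith) (by linarith)
    have m3 := h.trackA.mem (κ * s) (hs.1.trans hsκ) hs₁
    have m4 := h.trackB.mem (κ * s) (hs.1.trans hsκ) hs₁
    have t1 := hD.qhd_triangle m3 m1 m4
    have t2 := hD.qhd_triangle m1 m2 m4
    rw [hD.qhd_comm m2 m4] at t2
    have := hAB (κ * s) hsκ hs₁
    linarith
  simp only [sub_zero, hβL, hβ0] at hlowA hlowB
  rcases le_total (D / (32 * M)) (qhd Ω (A (κ * s)) (β (κ * s))) with hcase | hcase
  · exact ⟨_, _, _, _, _, hD.isBranching_of_geodesic hM hc h hDM hs.1 hκ hκ2 hs₁ hβ hβ0 hL hAB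
      hcase⟩
  · refine ⟨_, _, _, _, _, hD.isBranching_of_geodesic hM hc (hD.isBranching_swap h) hDM hs.1 hκ hκ2
      hs₁ hβ' hβ'0 hL (fun τ h1 h2 => ?_) ?_⟩
    · rw [hD.qhd_comm (h.trackB.mem τ (hs.1.trans h1) h2) (h.trackA.mem τ (hs.1.trans h1) h2)]
      exact hAB τ h1 h2
    · linarith

/-- The number of times that a branching can be refined is bounded by the doubling property. -/
lemma card_le_of_isBranching {Q M : ℝ} (hdoub : IsDoubling X Q) (hM : 1 ≤ M)
    (hc : LengthCigar Ω M) {n : ℕ} (hn : 6 * M ≤ 2 ^ (n + 1)) {p : X} (j : ℕ) :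
    ∀ {m : ℕ} {D s₀ s₁ : ℝ} {A B : ℝ → X} {O : Fin m → ℝ → X},
      IsBranching Ω M p m D s₀ s₁ A B O → 2048 * M ^ 3 * (32 * M) ^ j ≤ D →
        ((m + j : ℕ) : ℝ) ≤ Q ^ (n + 1) := by
  induction j with
  | zero =>
    intro m D s₀ s₁ A B O h hDM
    rw [pow_zero, mul_one] at hDM
    have hM3 : 1 ≤ M ^ 3 := one_le_pow₀ hM
    rw [add_zero]
    refine hD.card_le_of_one_le_qhd hdoub (by linarith) hn h.pos (v := fun i => O i s₀) (p := p)
      (fun i => (h.trackO i).mem _ le_rfl h.le) (fun i => (h.trackO i).dist_le _ le_rfl h.le)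
      (fun i => (h.trackO i).le_mul _ le_rfl h.le) fun i k hik => ?_
    have := h.sepO i k hik s₀ le_rfl h.le
    linarith
  | succ j ih =>
    intro m D s₀ s₁ A B O h hDM
    have h32 : 1 ≤ 32 * M := by linarith
    have hM3 : 0 < M ^ 3 := by positivity
    have h1 : 2048 * M ^ 3 ≤ D := by
      refine le_trans ?_ hDM
      exact le_mul_of_one_le_right (by positivity) (one_le_pow₀ h32)
    obtain ⟨t₀, t₁, A', B', O', h'⟩ := hD.exists_isBranching_succ hM hc h h1
    have := ih h' (by
      rw [le_div_iff₀ (by positivity), mul_assoc, ← pow_succ]; exact hDM)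
    rwa [show m + 1 + j = m + (j + 1) by ring] at this

end IsGeodesicSubdomain

/-! ### The Gehring–Hayman inequality -/

/-- A discrete intermediate value property: the first index at which `f` reaches `c` overshoots by
at most one step. -/
lemma exists_le_add_of_step {f : ℕ → ℝ} {D c : ℝ} (hD : 0 ≤ D) (h0 : f 0 ≤ c) {k : ℕ}
    (hstep : ∀ i < k, f (i + 1) ≤ f i + D) (hk : c ≤ f k) : ∃ i ≤ k, c ≤ f i ∧ f i ≤ c + D := by
  induction k with
  | zero => exact ⟨0, le_rfl, hk, by linarith⟩
  | succ k ih =>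
    by_cases h : c ≤ f k
    · obtain ⟨i, hi, h1, h2⟩ := ih (fun i hi => hstep i (by omega)) h
      exact ⟨i, by omega, h1, h2⟩
    · exact ⟨k + 1, le_rfl, hk, by linarith [hstep k (by omega)]⟩

namespace IsGeodesicSubdomain
variable (hD : IsGeodesicSubdomain Ω)
include hD

/-- In a chain of points of the same scale, some consecutive points are far apart if the first and
the last one are. -/
lemma qhd_lt_of_chain {Q M τ D : ℝ} (hdoub : IsDoubling X Q) (hM : 0 < M) {n N : ℕ}
    (hn : 6 * M ≤ 2 ^ (n + 1)) (hN : Q ^ (n + 1) < N) (hτ : 0 < τ) (hD1 : 1 ≤ D) {p : X} {k : ℕ}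
    {v : ℕ → X} (hv : ∀ i ≤ k, v i ∈ Ω) (hp : ∀ i ≤ k, dist (v i) p ≤ 2 * τ)
    (hd : ∀ i ≤ k, τ ≤ M * bdryDist Ω (v i))
    (hstep : ∀ i < k, qhd Ω (v i) (v (i + 1)) ≤ D) : qhd Ω (v 0) (v k) < 2 * N * D := by
  by_contra hlt
  rw [not_lt] at hlt
  have hv0 := hv 0 (Nat.zero_le _)
  -- Select `N` points whose distances from `v 0` lie in the bands `[2jD, 2jD + D]`; the gaps
  -- between bands keep them at least `D` apart, too many for doubling.
  have hex : ∀ j : Fin N, ∃ i ≤ k, 2 * (j : ℝ) * D ≤ qhd Ω (v 0) (v i) ∧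
      qhd Ω (v 0) (v i) ≤ 2 * (j : ℝ) * D + D := by
    intro j
    have hj : ((j : ℕ) : ℝ) ≤ N := by exact_mod_cast j.2.le
    refine exists_le_add_of_step (f := fun i => qhd Ω (v 0) (v i)) (by linarith) ?_
      (fun i hi => ?_) ?_
    · simp only [hD.qhd_self hv0]
      positivity
    · have := hD.qhd_triangle hv0 (hv i hi.le) (hv (i + 1) hi)
      have := hstep i hi
      linarith
    · refine le_trans ?_ hlt
      gcongr
  choose ι hιk hι1 hι2 using hex
  have hfar : ∀ a b : Fin N, a < b → 1 ≤ qhd Ω (v (ι a)) (v (ι b)) := by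
    intro a b hab
    have h1 := hD.qhd_triangle hv0 (hv _ (hιk a)) (hv _ (hιk b))
    have h2 : ((a : ℕ) : ℝ) + 1 ≤ (b : ℕ) := by exact_mod_cast hab
    have h3 := hι2 a
    have h4 := hι1 b
    nlinarith
  have := hD.card_le_of_one_le_qhd hdoub hM hn hτ (v := fun j => v (ι j)) (p := p)
    (fun j => hv _ (hιk j)) (fun j => hp _ (hιk j)) (fun j => hd _ (hιk j)) fun a b hab => by
      rcases lt_or_gt_of_ne hab with h | h
      · exact hfar a b h
      · rw [hD.qhd_comm (hv _ (hιk a)) (hv _ (hιk b))]; exact hfar b a h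
  linarith

/-- The quasihyperbolic distance between the points that split a long geodesic at arc length `δ`
from the end points, where the end points are joined by a curve of length at most `δ`. -/
lemma qhd_lt_of_long {Q M : ℝ} (hdoub : IsDoubling X Q) (hM : 1 ≤ M)
    (hc : LengthCigar Ω M) {n N : ℕ} (hn : 6 * M ≤ 2 ^ (n + 1)) (hN : Q ^ (n + 1) < N)
    {g u : ℝ → X} {L l δ : ℝ} (hg : IsGeod Ω g 0 L) (hu : IsCurve Ω u 0 l) (hδ : 0 < δ)
    (hl : l ≤ δ) (hu0 : u 0 = g 0) (hul : u l = g L) (hL : 20 * M * δ ≤ L)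
    (hd : bdryDist Ω (g 0) ≤ 4 * δ) :
    qhd Ω (g δ) (g (L - δ)) < 2 * N * (2048 * M ^ 3 * (32 * M) ^ N) := by
  have hM0 : 0 < M := by linarith
  set D := 2048 * M ^ 3 * (32 * M) ^ N with hDdef
  have hD8 : 2048 ≤ D := by
    have h1 : 1 ≤ M ^ 3 := one_le_pow₀ hM
    have h2 : 1 ≤ (32 * M) ^ N := one_le_pow₀ (by linarith)
    nlinarith [mul_le_mul h1 h2 zero_le_one (by linarith)]
  have hl0 := hu.le
  have hLδ : 20 * δ ≤ L := by nlinarith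
  have hg' := hD.isGeod_reverse_zero hg
  obtain ⟨r, hr, hrmin⟩ := isCompact_Icc.exists_isMinOn (nonempty_Icc.2 hl0)
    ((bdryDist_continuous Ω).comp_continuousOn hu.continuousOn)
  set ε := bdryDist Ω (u r) with hε
  have hε0 : 0 < ε := hD.bdryDist_pos (hu.mem r hr.1 hr.2)
  have hεle : ∀ s, 0 ≤ s → s ≤ l → ε ≤ bdryDist Ω (u s) := fun s h1 h2 => hrmin ⟨h1, h2⟩
  -- The mesh `δ / k` is small against the least boundary distance `ε` on `u`, so neighbouring
  -- geodesics are close at scale `δ / k`.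
  obtain ⟨k, hk⟩ := exists_nat_gt (max 1 (4 * δ / ε))
  have hk1 : (1 : ℝ) < k := (le_max_left _ _).trans_lt hk
  have hk0 : (0 : ℝ) < k := by linarith
  have hkε : 4 * (δ / k) < ε := by
    have := (le_max_right _ _).trans_lt hk
    rw [div_lt_iff₀ hε0] at this
    rw [← mul_div_assoc, div_lt_iff₀ hk0]
    linarith
  set σ : ℕ → ℝ := fun i => i * l / k with hσ
  have hσ0 : ∀ i, 0 ≤ σ i := fun i => by simp only [hσ]; positivity
  have hσl : ∀ i ≤ k, σ i ≤ l := fun i hi => by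
    have : (i : ℝ) ≤ k := by exact_mod_cast hi
    simp only [hσ]
    rw [div_le_iff₀ hk0]
    nlinarith
  have hw : 10 * δ ≤ bdryDist Ω (g (L / 2)) := by
    have := hc.le_mul hg (τ := L / 2) (by linarith) (by linarith)
    by_contra hn
    nlinarith
  have hgw := hg.mem (L / 2) (by linarith) (by linarith)
  have : Nonempty X := ⟨g 0⟩
  -- The fan from the points of `u` to the midpoint of `g`, with `g` and its reversal as first and
  -- last members. The others are long because the midpoint has boundary distance at least `10 * δ`,
  -- against at most `5 * δ` on `u`.
  have hex : ∀ i, i ≤ k → ∃ (G : ℝ → X) (Λ : ℝ), IsGeod Ω G 0 Λ ∧ G 0 = u (σ i) ∧ 2 * δ ≤ Λ ∧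
      (i = 0 → G δ = g δ) ∧ (i = k → G δ = g (L - δ)) := by
    intro i hi
    have hkne : (0 : ℕ) ≠ k := by rintro rfl; simp at hk0
    by_cases h0 : i = 0
    · subst h0
      exact ⟨g, L, hg, by simp [hσ, hu0], by linarith, fun _ => rfl, fun h => absurd h hkne⟩
    by_cases h1 : i = k
    · subst h1
      refine ⟨_, L, hg', ?_, by linarith, fun h => absurd h h0, fun _ => rfl⟩
      simp only [hσ, sub_zero, mul_div_cancel_left₀ l hk0.ne', hul]
    · obtain ⟨G, Λ, hG, hG0, hGΛ⟩ := hD.exists_isGeod (hu.mem _ (hσ0 i) (hσl i hi)) hgw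
      refine ⟨G, Λ, hG, hG0, ?_, fun h => absurd h h0, fun h => absurd h h1⟩
      have e1 := hG.dist_le 0 Λ le_rfl hG.le le_rfl
      rw [hG0, hGΛ] at e1
      have e2 := bdryDist_le_add Ω (g (L / 2)) (u (σ i))
      have e3 := bdryDist_le_add Ω (u (σ i)) (u 0)
      have e4 := hu.dist_le 0 (σ i) le_rfl (hσ0 i) (hσl i hi)
      rw [dist_comm] at e2 e4
      rw [hu0] at e3 e4
      linarith [hσl i hi]
  choose! G Λ hG hG0 hΛ hfirst hlast using hex
  have hnear : ∀ i ≤ k, ∀ s, 0 ≤ s → s ≤ δ → dist (G i s) (u (σ i)) ≤ s := by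
    intro i hi s h1 h2
    have := (hG i hi).dist_le 0 s le_rfl h1 (by linarith [hΛ i hi])
    rwa [hG0 i hi, sub_zero, dist_comm] at this
  have hmem : ∀ i ≤ k, ∀ s, 0 ≤ s → s ≤ δ → G i s ∈ Ω := fun i hi s h1 h2 =>
    (hG i hi).mem s h1 (by linarith [hΛ i hi])
  have hstep : ∀ i < k, qhd Ω (G i δ) (G (i + 1) δ) ≤ D := by
    intro i hi
    by_contra hlt
    rw [not_le] at hlt
    have hi1 : i + 1 ≤ k := hi
    have hs0 : 0 < δ / k := by positivity
    have hsδ : δ / k ≤ δ := div_le_self hδ.le hk1.le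
    have hui := hu.mem _ (hσ0 i) (hσl i hi.le)
    have hudist : dist (u (σ (i + 1))) (u (σ i)) ≤ δ / k := by
      have hadd : σ (i + 1) - σ i = l / k := by simp only [hσ]; push_cast; ring
      have hle : σ i ≤ σ (i + 1) := by
        have : 0 ≤ l / k := by positivity
        linarith
      rw [dist_comm]
      refine (hu.dist_le _ _ (hσ0 i) hle (hσl _ hi1)).trans ?_
      rw [hadd]
      gcongr
    have t1 := hc.isTrack hM0 (hG i hi.le) hs0 (hΛ i hi.le) (p := u (σ i))
      (by rw [hG0 i hi.le, dist_self]; exact hs0.le)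
    have t2 := hc.isTrack hM0 (hG (i + 1) hi1) hs0 (hΛ _ hi1) (p := u (σ i))
      (by rw [hG0 _ hi1]; exact hudist)
    have hbot : qhd Ω (G i (δ / k)) (G (i + 1) (δ / k)) ≤ D / 4 := by
      have hεi := hεle _ (hσ0 i) (hσl i hi.le)
      have d1 := hnear i hi.le _ hs0.le hsδ
      have d2 := t2.dist_le _ le_rfl hsδ
      have m1 := hmem i hi.le _ hs0.le hsδ
      have m2 := hmem _ hi1 _ hs0.le hsδ
      have q1 := hD.qhd_lt_one hui (show dist (u (σ i)) (G i (δ / k)) < _ by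
        rw [dist_comm]; linarith)
      have q2 := hD.qhd_lt_one hui (show dist (u (σ i)) (G (i + 1) (δ / k)) < _ by
        rw [dist_comm]; linarith)
      have := hD.qhd_triangle m1 hui m2
      rw [hD.qhd_comm m1 hui] at this
      linarith
    -- A branching with no extra tracks whose gap allows `N` refinements, more than doubling
    -- permits.
    have hbr : IsBranching Ω M (u (σ i)) 0 D (δ / k) δ (G i) (G (i + 1)) (fun j => j.elim0) :=
      ⟨hs0, hsδ, t1, t2, fun j => j.elim0, hbot, hlt.le, fun j => j.elim0, fun j => j.elim0,
        fun j => j.elim0⟩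
    have := hD.card_le_of_isBranching hdoub hM hc hn N hbr le_rfl
    rw [zero_add] at this
    linarith
  have hfin := hD.qhd_lt_of_chain hdoub hM0 hn hN hδ (by linarith) (p := g 0) (k := k)
    (v := fun i => G i δ) (fun i hi => hmem i hi δ hδ.le le_rfl)
    (fun i hi => by
      have e1 := hnear i hi δ hδ.le le_rfl
      have e2 := hu.dist_le 0 (σ i) le_rfl (hσ0 i) (hσl i hi)
      rw [dist_comm, hu0] at e2
      have := dist_triangle (G i δ) (u (σ i)) (g 0)
      linarith [hσl i hi])
    (fun i hi => hc.le_mul (hG i hi) hδ.le (hΛ i hi)) hstep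
  simp only [hfirst 0 (Nat.zero_le _) rfl, hlast k le_rfl rfl] at hfin
  exact hfin

/-- For a long `g` starting near the boundary, `qhd_lt_of_long` bounds the part between arc lengths
`δ` and `L - δ`. If `bdryDist Ω (g 0)` exceeds `4 * δ`, the end points are quasihyperbolically close
and the local estimate suffices. -/
lemma length_le_mul {Q M : ℝ} (hdoub : IsDoubling X Q) (hM : 1 ≤ M)
    (hc : LengthCigar Ω M) {n N : ℕ} (hn : 6 * M ≤ 2 ^ (n + 1)) (hN : Q ^ (n + 1) < N)
    {g u : ℝ → X} {L l δ : ℝ} (hg : IsGeod Ω g 0 L) (hu : IsCurve Ω u 0 l) (hδ : 0 < δ)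
    (hl : l ≤ δ) (hu0 : u 0 = g 0) (hul : u l = g L) :
    L ≤ (20 * M + 5 * Real.exp (2 * N * (2048 * M ^ 3 * (32 * M) ^ N))) * δ := by
  set F := 2 * N * (2048 * M ^ 3 * (32 * M) ^ N) with hF
  have hF0 := Real.exp_pos F
  have hx := hg.mem 0 le_rfl hg.le
  have hpos := hD.bdryDist_pos hx
  by_cases hshort : L ≤ 20 * M * δ
  · nlinarith
  rw [not_le] at hshort
  have hLδ : 20 * δ ≤ L := by nlinarith
  by_cases hd : bdryDist Ω (g 0) ≤ 4 * δ
  · have hq := hD.qhd_lt_of_long hdoub hM hc hn hN hg hu hδ hl hu0 hul hshort.le hd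
    have e1 := hD.sub_le_mul_exp (hD.isGeod_sub hg hδ.le (show δ ≤ L - δ by linarith)
      (by linarith))
    have e2 := bdryDist_le_add Ω (g δ) (g 0)
    have e3 := hg.dist_le 0 δ le_rfl hδ.le (by linarith)
    rw [dist_comm] at e3
    have e4 : bdryDist Ω (g δ) * Real.exp (qhd Ω (g δ) (g (L - δ))) ≤ (5 * δ) * Real.exp F :=
      mul_le_mul (by linarith) (Real.exp_le_exp.2 hq.le) (Real.exp_pos _).le (by linarith)
    have e5 := bdryDist_nonneg Ω (g δ)
    nlinarith
  · rw [not_le] at hd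
    have hxy : dist (g 0) (g L) ≤ δ := by
      rw [← hu0, ← hul]
      exact (hu.dist_le 0 l le_rfl hu.le le_rfl).trans (by linarith)
    have e1 := hD.qhd_le_of_dist_lt hx (show dist (g 0) (g L) < _ by linarith)
    have e2 := hD.sub_le_mul_exp hg
    set t := qhd Ω (g 0) (g L) with ht
    have ht0 : 0 ≤ t := qhd_nonneg _ _ _
    rw [le_div_iff₀ hpos] at e1
    have ht1 : t ≤ 1 := by
      by_contra hn
      nlinarith
    have e3 := Real.abs_exp_sub_one_le (x := t) (by rwa [abs_of_nonneg ht0])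
    rw [abs_of_nonneg ht0] at e3
    have e4 := (le_abs_self _).trans e3
    have e5 : bdryDist Ω (g 0) * Real.exp t ≤ bdryDist Ω (g 0) * (1 + 2 * t) := by
      gcongr; linarith
    nlinarith

/-- A quantitative Gehring–Hayman inequality. -/
lemma gehringHayman {Q M : ℝ} (hdoub : IsDoubling X Q) (hM : 1 ≤ M)
    (hc : LengthCigar Ω M) {n N : ℕ} (hn : 6 * M ≤ 2 ^ (n + 1)) (hN : Q ^ (n + 1) < N) :
    GehringHayman Ω (20 * M + 5 * Real.exp (2 * N * (2048 * M ^ 3 * (32 * M) ^ N))) := by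
  intro x _ y _ γ hγ
  set K := 20 * M + 5 * Real.exp (2 * N * (2048 * M ^ 3 * (32 * M) ^ N)) with hK
  have hK0 : 0 < K := by have := Real.exp_pos (2 * N * (2048 * M ^ 3 * (32 * M) ^ N)); positivity
  have hg := isGeod_arcLengthParam hγ
  rw [← ENNReal.div_le_iff' (by simpa using hK0) ENNReal.ofReal_ne_top]
  refine le_iInf₂ fun α hα => ?_
  rw [ENNReal.div_le_iff' (by simpa using hK0) ENNReal.ofReal_ne_top]
  rw [← ENNReal.ofReal_toReal hγ.1.2, ← ENNReal.ofReal_toReal hα.2, ← ENNReal.ofReal_mul hK0.le]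
  apply ENNReal.ofReal_le_ofReal
  have hu := isCurve_arcLengthParam hα
  have key : ∀ δ, (length α).toReal < δ → (length γ).toReal ≤ K * δ := by
    intro δ hδ
    refine hD.length_le_mul hdoub hM hc hn hN hg hu (ENNReal.toReal_nonneg.trans_lt hδ) hδ.le ?_ ?_
    · rw [arcLengthParam_zero hα.2, arcLengthParam_zero hγ.1.2]
    · rw [arcLengthParam_length hα.2, arcLengthParam_length hγ.1.2]
  rw [← div_le_iff₀' hK0]
  -- `length_le_mul` needs `δ` positive, so `δ` decreases to the length of `α`, which may be 0.
  refine le_of_forall_gt_imp_ge_of_dense fun δ hδ => ?_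
  rw [div_le_iff₀' hK0]
  exact key δ hδ

/-- A quasihyperbolic geodesic satisfies the cigar condition for its arc length. -/
lemma isInnerUniform {M K : ℝ} (hc : LengthCigar Ω M) (hK1 : 1 ≤ K) (hMK : M ≤ K)
    (hGH : GehringHayman Ω K) : IsInnerUniform Ω K := by
  refine ⟨hK1, fun x hx y hy => ?_⟩
  obtain ⟨γ, hγ⟩ := hD.geodesic x hx y hy
  refine ⟨γ, hγ.1, fun t => ?_, hGH x hx y hy γ hγ⟩
  have hlen := hγ.1.2
  have ht := arcPos_mem hlen t
  have := hc _ _ _ (arcPos γ t) (isGeod_arcLengthParam hγ) ht.1 ht.2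
  rw [arcLengthParam_arcPos hlen, sub_zero] at this
  rw [eVariationOn_Iic hlen, eVariationOn_Ici hlen, ← ENNReal.ofReal_min]
  apply ENNReal.ofReal_le_ofReal
  exact this.trans (mul_le_mul_of_nonneg_right hMK (bdryDist_nonneg _ _))

end IsGeodesicSubdomain

lemma GehringHayman.mono {K K' : ℝ} (h : GehringHayman Ω K) (hK : K ≤ K') :
    GehringHayman Ω K' := fun x hx y hy γ hγ =>
  (h x hx y hy γ hγ).trans (mul_le_mul_left (ENNReal.ofReal_le_ofReal hK) _)

/-! ### The constants -/

/-- The constants of the quantitative argument are dominated by `constC₁`. -/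
lemma exists_constants {Q c₀ C : ℝ} (hQ : 1 < Q) (hA : 1 ≤ c₀ * C) :
    ∃ n n' N : ℕ, 40 * (c₀ * C) ^ 2 ≤ 2 ^ (n + 1) ∧
      6 * (8 * (c₀ * C) * Q ^ (n + 1)) ≤ 2 ^ (n' + 1) ∧ Q ^ (n' + 1) < N ∧
      20 * (8 * (c₀ * C) * Q ^ (n + 1)) + 5 * Real.exp (2 * N *
        (2048 * (8 * (c₀ * C) * Q ^ (n + 1)) ^ 3 * (32 * (8 * (c₀ * C) * Q ^ (n + 1))) ^ N)) ≤
        constC₁ Q c₀ C := by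
  set A := c₀ * C with hAdef
  have hQ0 : 0 < Q := by linarith
  have hA2 : 1 ≤ A ^ 2 := one_le_pow₀ hA
  have hAA : A ≤ A ^ 2 := by nlinarith
  set lQ := Real.logb 2 Q with hlQ
  have hlQ0 : 0 < lQ := Real.logb_pos (by norm_num) hQ
  set E := (210 * A) ^ 2 * (Real.logb 2 (2 * Q) + 1) with hE
  have hE' : E = 44100 * A ^ 2 * (lQ + 2) := by
    rw [hE, Real.logb_mul (by norm_num) hQ0.ne', Real.logb_self_eq_one (by norm_num)]
    ring
  set B := constC₂ Q c₀ C with hB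
  have hBE : B = 1764 * A ^ 2 * Q ^ E := by
    rw [hB, constC₂, mul_assoc 42, mul_assoc 210, ← hAdef, ← hE]
    ring
  -- The crude bound `k ≤ 2 ^ k` makes this `n` sufficient; a true logarithm is needed only for
  -- `n'`, since `M` is already exponential in `n`.
  obtain ⟨n, hn⟩ : ∃ n : ℕ, n + 1 = ⌈40 * A ^ 2⌉₊ :=
    ⟨⌈40 * A ^ 2⌉₊ - 1, Nat.sub_add_cancel (Nat.ceil_pos.2 (by positivity))⟩
  have hn1 : 40 * A ^ 2 ≤ ((n + 1 : ℕ) : ℝ) := by rw [hn]; exact Nat.le_ceil _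
  have hn2 : ((n + 1 : ℕ) : ℝ) ≤ 41 * A ^ 2 := by
    rw [hn]; linarith [Nat.ceil_lt_add_one (show 0 ≤ 40 * A ^ 2 by positivity)]
  set M := 8 * A * Q ^ (n + 1) with hMdef
  have hQn : 1 ≤ Q ^ (n + 1) := one_le_pow₀ hQ.le
  have hM : 1 ≤ M := by nlinarith
  have hM0 : 0 < M := by linarith
  obtain ⟨n', hn'⟩ : ∃ n' : ℕ, n' + 1 = ⌈Real.logb 2 (6 * M)⌉₊ :=
    ⟨⌈Real.logb 2 (6 * M)⌉₊ - 1, Nat.sub_add_cancel (Nat.ceil_pos.2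
      (Real.logb_pos (by norm_num) (by linarith)))⟩
  have hn'1 : Real.logb 2 (6 * M) ≤ ((n' + 1 : ℕ) : ℝ) := by rw [hn']; exact Nat.le_ceil _
  have hn'2 : ((n' + 1 : ℕ) : ℝ) ≤ Real.logb 2 (6 * M) + 1 := by
    rw [hn']
    exact (Nat.ceil_lt_add_one (Real.logb_nonneg (by norm_num) (by linarith))).le
  have hlog48 : Real.logb 2 (48 * A) ≤ 48 * A := by
    rw [Real.logb_le_iff_le_rpow (by norm_num) (by positivity)]
    have h1 := one_add_mul_self_le_rpow_one_add (s := 1) (by norm_num)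
      (p := 48 * A) (by linarith)
    norm_num at h1
    linarith
  have hlogM : Real.logb 2 (6 * M) ≤ 48 * A + 41 * A ^ 2 * lQ := by
    rw [hMdef, show 6 * (8 * A * Q ^ (n + 1)) = (48 * A) * Q ^ (n + 1) by ring,
      Real.logb_mul (by positivity) (by positivity), Real.logb_pow]
    have := mul_le_mul_of_nonneg_right hn2 hlQ0.le
    linarith
  have hQE : Q ^ (n' + 1) ≤ Q ^ E := by
    rw [← Real.rpow_natCast]
    apply Real.rpow_le_rpow_of_exponent_le hQ.le
    rw [hE']
    nlinarith [mul_pos (show 0 < A ^ 2 by positivity) hlQ0]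
  have hQnE : Q ^ (n + 1) ≤ Q ^ E := by
    rw [← Real.rpow_natCast]
    apply Real.rpow_le_rpow_of_exponent_le hQ.le
    rw [hE']
    nlinarith [mul_pos (show 0 < A ^ 2 by positivity) hlQ0]
  have hQE1 : 1 ≤ Q ^ E := hQn.trans hQnE
  have hB1 : 1764 * Q ^ E ≤ B := by rw [hBE]; nlinarith
  have hB0 : 1764 ≤ B := by linarith
  have hMB : 32 * M ≤ B := by
    rw [hBE, hMdef]
    have : A * Q ^ (n + 1) ≤ A ^ 2 * Q ^ E := mul_le_mul hAA hQnE (by positivity) (by positivity)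
    have h0 : 0 ≤ A ^ 2 * Q ^ E := by positivity
    nlinarith
  refine ⟨n, n', ⌊Q ^ (n' + 1)⌋₊ + 1, ?_, ?_, ?_, ?_⟩
  · refine hn1.trans ?_
    exact_mod_cast (Nat.lt_two_pow_self (n := n + 1)).le
  · rw [Real.logb_le_iff_le_rpow (by norm_num) (by positivity), Real.rpow_natCast] at hn'1
    exact hn'1
  · exact_mod_cast Nat.lt_floor_add_one (Q ^ (n' + 1))
  set N := ⌊Q ^ (n' + 1)⌋₊ + 1 with hNdef
  have hNB : (N : ℝ) ≤ B := by
    have := Nat.floor_le (show 0 ≤ Q ^ (n' + 1) by positivity)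
    rw [hNdef]; push_cast; linarith
  -- `N` and `32 * M` are at most `B`, so the exponent is at most `B ^ (N + 4)`. One more factor `B`
  -- absorbs the outer constants, and `N + 5` is below `3 + 4 * B ^ 2`.
  set G := B ^ (N + 4) with hG
  have hBG : B ≤ G := le_self_pow₀ (by linarith) (by omega)
  have hF : 2 * N * (2048 * M ^ 3 * (32 * M) ^ N) ≤ G := by
    calc 2 * N * (2048 * M ^ 3 * (32 * M) ^ N) = N * ((32 * M) ^ (N + 3) / 8) := by
          rw [pow_add]; ring
      _ ≤ N * ((32 * M) ^ (N + 3)) := by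
          have h0 : 0 ≤ (32 * M) ^ (N + 3) := by positivity
          gcongr
          linarith
      _ ≤ B * B ^ (N + 3) := by gcongr
      _ = G := by rw [hG]; ring
  have hGe := Real.add_one_le_exp G
  have hexpF := Real.exp_le_exp.2 hF
  have hsum : 20 * M + 5 * Real.exp (2 * N * (2048 * M ^ 3 * (32 * M) ^ N)) ≤
      6 * Real.exp G := by linarith
  refine hsum.trans ?_
  have h6 : (6 : ℝ) ≤ Real.exp G := by linarith
  calc 6 * Real.exp G ≤ Real.exp G * Real.exp G := by gcongr
    _ = Real.exp (2 * G) := by rw [← Real.exp_add]; congr 1; ring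
    _ ≤ Real.exp (B ^ (N + 5)) := by
        apply Real.exp_le_exp.2
        rw [show N + 5 = (N + 4) + 1 by ring, pow_succ, ← hG]
        nlinarith
    _ ≤ constC₁ Q c₀ C := by
        rw [constC₁, ← hB]
        apply Real.exp_le_exp.2
        rw [← Real.rpow_natCast]
        apply Real.rpow_le_rpow_of_exponent_le (by linarith)
        push_cast
        nlinarith

end QHDomain

/-! ### The main theorem -/

theorem theorem1p6 {X : Type*} [MetricSpace X] (hX : QHDomain.IsLengthSpace X)
    (Q : ℝ) (hQ : 1 < Q) (hdoub : QHDomain.IsDoubling X Q)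
    (Ω : Set X) (hΩ : QHDomain.IsProperSubdomain Ω)
    (hgeo : QHDomain.IsQHGeodesicDomain Ω)
    (c₀ C : ℝ) (hc₀ : 0 < c₀) (hC : 0 < C)
    (hLLC : QHDomain.IsLLC2 Ω c₀) (hsep : QHDomain.BallSeparation Ω C) :
    QHDomain.IsInnerUniform Ω (QHDomain.constC₁ Q c₀ C) ∧
      QHDomain.GehringHayman Ω (QHDomain.constC₁ Q c₀ C) := by
  have hD : QHDomain.IsGeodesicSubdomain Ω := ⟨hX, hΩ, hgeo⟩
  have hdc := QHDomain.diamCigar_of_ballSeparation hc₀ hC hLLC hsep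
  have hA := hD.one_le_of_diamCigar (mul_pos hc₀ hC) hdc
  obtain ⟨n, n', N, hn, hn', hN, hK⟩ := QHDomain.exists_constants hQ hA
  have hcigar := hD.lengthCigar hA hdc hdoub hn
  have hM : 1 ≤ 8 * (c₀ * C) * Q ^ (n + 1) := by
    have : 1 ≤ Q ^ (n + 1) := one_le_pow₀ hQ.le
    nlinarith
  have hGH := (hD.gehringHayman hdoub hM hcigar hn' hN).mono hK
  have hMK := le_trans (by
    have := Real.exp_pos (2 * N * (2048 * (8 * (c₀ * C) * Q ^ (n + 1)) ^ 3 *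
      (32 * (8 * (c₀ * C) * Q ^ (n + 1))) ^ N))
    linarith : 8 * (c₀ * C) * Q ^ (n + 1) ≤ _) hK
  exact ⟨hD.isInnerUniform hcigar (hM.trans hMK) hMK hGH, hGH⟩
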